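/- Consider a network with $L$ links of capacities $C_1,\dots,C_L>0$ and $K$ classes of flows. Class $k$ has a route $r_k=(r_k(1),\dots,r_k(d_k))$, $d_k\ge 1$, of distinct links, an access rate $a_k>0$, a Poisson arrival intensity $\lambda_k\ge 0$, and independent exponential flow sizes with mean $1/\mu_k$, $\mu_k>0$. The network is acyclic: the links can be numbered so that every route is an increasing sequence. For a vector $x\in\mathbb R_+^K$ of input rates, let $\theta_k^i(x)$ ($0\le i\le d_k$) be the unique solution of the tail dropping equations $$\theta_k^0(x)=x_k,\qquad \theta_k^i(x)=\theta_k^{i-1}(x)\min\Big(\frac{C_l}{R_l(x)},1\Big)\ \text{ with } l=r_k(i),\qquad R_l(x)=\sum_{k,i:\,r_k(i+1)=l}\theta_k^{i}(x)$$ (no loss at link $l$ if $R_l(x)\le C_l$), and let $\psi_k(x)=\theta_k^{d_k}(x)$. Write $a\odot n=(a_kn_k)_k$. The process of the numbers of flows in progress is a càdlàg Markov process on $\mathbb N^K$ with transition rates $\lambda_k$ from $n$ to $n+e_k$ and $\mu_k\psi_k(a\odot n)$ from $n$ to $n-e_k$. For each integer $\beta\ge 1$ let $N_\beta$ be such a process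 for the network in which, for every $k$, $a_k$, $\lambda_k$, $\mu_k$ are replaced by $a_k/\beta$, $\beta\lambda_k$, $\beta\mu_k$ (capacities and routes being unchanged). Suppose that $\beta^{-1}a\odot N_\beta(0)$ converges in probability, as $\beta\to\infty$, to a deterministic vector $x_0$. Then the differential equation $$\frac{d\bar X_k}{dt}(t)=a_k\lambda_k-a_k\mu_k\psi_k(\bar X(t)),\qquad t\ge 0,\ 1\le k\le K,\qquad \bar X(0)=x_0,$$ has a unique solution $\bar X:[0,\infty)\to\mathbb R_+^K$, and $\beta^{-1}a\odot N_\beta$ converges to $\bar X$ in probability uniformly on compact sets: for all $T\ge 0$ and $\varepsilon>0$, $$\lim_{\beta\to\infty}\mathbb P\Big(\sup_{0\le t\le T}\big\|\beta^{-1}a\odot N_\beta(t)-\bar X(t)\big\|_\infty\ge\varepsilon\Big)=0 .$$ -/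

import Mathlib

open MeasureTheory ProbabilityTheory Filter Topology Set
open scoped NNReal ENNReal

noncomputable section

/-- A network with `L` links and `K` classes of flows: link capacities `C_l`, routes `r_k` (nonempty
ordered lists of distinct links), access rates `a_k`, flow arrival rates `lambda_k`, and inverse
mean flow sizes `mu_k`. -/
structure FlowNetwork (L K : ℕ) where
  capacity : Fin L → ℝ
  capacity_pos : ∀ l, 0 < capacity l
  route : Fin K → List (Fin L)
  route_ne_nil : ∀ k, route k ≠ []
  route_nodup : ∀ k, (route k).Nodup
  accessRate : Fin K → ℝ
  accessRate_pos : ∀ k, 0 < accessRate k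
  arrivalRate : Fin K → ℝ
  arrivalRate_nonneg : ∀ k, 0 ≤ arrivalRate k
  serviceRate : Fin K → ℝ
  serviceRate_pos : ∀ k, 0 < serviceRate k

namespace FlowNetwork

variable {L K : ℕ}

/-- The links can be numbered in such a way that each route is an increasing sequence of
numbers. -/
def IsAcyclic (net : FlowNetwork L K) : Prop :=
  ∃ σ : Equiv.Perm (Fin L), ∀ k, (net.route k).Pairwise (fun l l' => σ l < σ l')

/-- `θ k i` is the rate of class `k` at the output of the `i`-th link of its route (links of a route
being counted from `1`, and `i = 0` being the source).  The total input rate of link `l` sums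
`θ k i` over the pairs `(k, i)` for which the link number `i + 1` of route `k`, that is
the list entry `(route k)[i]`, is `l`. -/
def inputRate (net : FlowNetwork L K) (θ : Fin K → ℕ → ℝ) (l : Fin L) : ℝ :=
  ∑ k, ∑ i : Fin (net.route k).length, if (net.route k)[i] = l then θ k i else 0

/-- The proportion `min (C / R) 1` of the input that a link of capacity `C` lets through when its
total input rate is `R`; there is no loss if `R ≤ C` (in particular if `R = 0`). -/
def passRatio (C R : ℝ) : ℝ := if R ≤ C then 1 else C / R

/-- The tail dropping equations for the input rates `x`. -/
def IsTailDropping (net : FlowNetwork L K) (x : Fin K → ℝ) (θ : Fin K → ℕ → ℝ) : Prop :=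
  (∀ k, θ k 0 = x k) ∧
  ∀ k, ∀ i : Fin (net.route k).length,
    θ k (i + 1) = θ k i *
      passRatio (net.capacity (net.route k)[i]) (net.inputRate θ (net.route k)[i])

/-- In an acyclic network the tail dropping equations have at most one solution. -/
theorem IsTailDropping.unique {net : FlowNetwork L K} (hnet : net.IsAcyclic) {x : Fin K → ℝ}
    {θ θ' : Fin K → ℕ → ℝ} (h : net.IsTailDropping x θ) (h' : net.IsTailDropping x θ')
    (k : Fin K) (i : ℕ) (hi : i ≤ (net.route k).length) : θ k i = θ' k i := by
  obtain ⟨σ, hσ⟩ := hnet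
  have key : ∀ n : ℕ, ∀ k i, i ≤ (net.route k).length →
      (∀ j (hj : j < (net.route k).length), j < i → (σ ((net.route k)[j]) : ℕ) < n) →
      θ k i = θ' k i := by
    intro n
    induction n with
    | zero =>
      intro k i hi hlt
      rcases i with _ | i
      · rw [h.1, h'.1]
      · exact absurd (hlt i (by omega) (by omega)) (by omega)
    | succ n ih =>
      intro k i hi hlt
      rcases i with _ | i
      · rw [h.1, h'.1]
      have hσi : (σ ((net.route k)[i]) : ℕ) < n + 1 := hlt i (by omega) (by omega)
      have prev : ∀ k' i' (hi' : i' < (net.route k').length),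
          (σ ((net.route k')[i']) : ℕ) < n + 1 → θ k' i' = θ' k' i' := by
        intro k' i' hi' hs
        refine ih k' i' hi'.le fun j hj hji => ?_
        have := List.pairwise_iff_getElem.1 (hσ k') j i' hj hi' hji
        have : (σ ((net.route k')[j]) : ℕ) < σ ((net.route k')[i']) := this
        omega
      have e1 := h.2 k ⟨i, hi⟩
      have e2 := h'.2 k ⟨i, hi⟩
      have eR : net.inputRate θ (net.route k)[i] = net.inputRate θ' (net.route k)[i] := by
        unfold inputRate
        refine Finset.sum_congr rfl fun k' _ => Finset.sum_congr rfl fun i' _ => ?_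
        split_ifs with hc
        · refine prev k' i' i'.2 ?_
          have hc' : (net.route k')[(i' : ℕ)] = (net.route k)[i] := hc
          rw [hc']; exact hσi
        · rfl
      simp only [Fin.getElem_fin] at e1 e2
      rw [e1, e2, eR, prev k i hi hσi]
  exact key L k i hi fun j hj _ => (σ _).2

/-- The class rates after the links of number less than `n` have been processed. -/
def stageRate (net : FlowNetwork L K) (σ : Equiv.Perm (Fin L)) (x : Fin K → ℝ) :
    ℕ → Fin K → ℝ
  | 0 => x
  | n + 1 => fun k =>
    if hn : n < L then
      if σ.symm ⟨n, hn⟩ ∈ net.route k then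
        stageRate net σ x n k * passRatio (net.capacity (σ.symm ⟨n, hn⟩))
          (net.inputRate (fun k' _ => stageRate net σ x n k') (σ.symm ⟨n, hn⟩))
      else stageRate net σ x n k
    else stageRate net σ x n k

/-- In an acyclic network the tail dropping equations have a solution. -/
theorem exists_isTailDropping {net : FlowNetwork L K} (hnet : net.IsAcyclic) (x : Fin K → ℝ) :
    ∃ θ, net.IsTailDropping x θ := by
  obtain ⟨σ, hσ⟩ := hnet
  set y := stageRate net σ x with hy
  have const : ∀ k m n, m ≤ n → (∀ l ∈ net.route k, m ≤ (σ l : ℕ) → n ≤ (σ l : ℕ)) →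
      y n k = y m k := by
    intro k m n hmn
    induction n, hmn using Nat.le_induction with
    | base => intro _; rfl
    | succ n hmn ih =>
      intro hl
      rw [← ih fun l hlk hm => (Nat.le_succ n).trans (hl l hlk hm)]
      simp only [hy, stageRate]
      split_ifs with h1 h2
      · have := hl _ h2 (by simpa using hmn)
        simp at this
      · rfl
      · rfl
  let θ : Fin K → ℕ → ℝ := fun k i =>
    match i with
    | 0 => x k
    | i + 1 => if hi : i < (net.route k).length then y ((σ ((net.route k)[i]) : ℕ) + 1) k else 0
  have hθ : ∀ k i (hi : i < (net.route k).length), θ k i = y (σ ((net.route k)[i]) : ℕ) k := by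
    intro k i hi
    have mono : ∀ j (hj : j < (net.route k).length), i < j →
        (σ ((net.route k)[i]) : ℕ) < σ ((net.route k)[j]) := fun j hj hij =>
      List.pairwise_iff_getElem.1 (hσ k) i j hi hj hij
    rcases i with _ | i
    · refine (const k 0 _ (Nat.zero_le _) ?_).symm
      intro l hl _
      obtain ⟨j, hj, rfl⟩ := List.getElem_of_mem hl
      rcases Nat.eq_zero_or_pos j with rfl | hj0
      · exact le_rfl
      · exact (mono j hj hj0).le
    · have hi' : i < (net.route k).length := by omega
      have hlt : (σ ((net.route k)[i]) : ℕ) < σ ((net.route k)[i + 1]) :=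
        List.pairwise_iff_getElem.1 (hσ k) i (i + 1) hi' hi (by omega)
      simp only [θ, hi', dif_pos]
      refine (const k _ _ hlt ?_).symm
      intro l hl hle
      obtain ⟨j, hj, rfl⟩ := List.getElem_of_mem hl
      rcases lt_trichotomy j (i + 1) with hj1 | rfl | hj1
      · rcases Nat.lt_or_ge j i with hj2 | hj2
        · have : (σ ((net.route k)[j]) : ℕ) < σ ((net.route k)[i]) :=
            List.pairwise_iff_getElem.1 (hσ k) j i hj hi' hj2
          omega
        · have : j = i := by omega
          subst this
          omega
      · exact le_rfl
      · exact (mono j hj hj1).le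
  refine ⟨θ, fun k => rfl, fun k i => ?_⟩
  have hi := i.2
  have e1 : θ k (i + 1) = y ((σ ((net.route k)[i]) : ℕ) + 1) k := by
    simp [θ]
  have eR : net.inputRate θ (net.route k)[i] =
      net.inputRate (fun k' _ => y (σ ((net.route k)[i]) : ℕ) k') (net.route k)[i] := by
    unfold inputRate
    refine Finset.sum_congr rfl fun k' _ => Finset.sum_congr rfl fun i' _ => ?_
    split_ifs with hc
    · rw [hθ k' i' i'.2, ← hc]; rfl
    · rfl
  rw [e1, eR, hθ k i hi]
  simp only [hy, stageRate]
  simp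

open Classical in
/-- The bandwidth allocation `ψ`: `throughput x k` is the rate of class `k` at the output of
the last link of its route, when the input rates are `x` (`0` if the tail dropping equations
have no solution, which does not happen in an acyclic network). -/
def throughput (net : FlowNetwork L K) (x : Fin K → ℝ) (k : Fin K) : ℝ :=
  if h : ∃ θ, net.IsTailDropping x θ then h.choose k (net.route k).length else 0

theorem throughput_eq {net : FlowNetwork L K} (hnet : net.IsAcyclic) {x : Fin K → ℝ}
    {θ : Fin K → ℕ → ℝ} (h : net.IsTailDropping x θ) (k : Fin K) :
    net.throughput x k = θ k (net.route k).length := by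
  have hex : ∃ θ, net.IsTailDropping x θ := ⟨θ, h⟩
  rw [throughput, dif_pos hex]
  exact IsTailDropping.unique hnet hex.choose_spec h k _ le_rfl

/-- The allocation as a function of the numbers of flows: `φ n = ψ (a ⊙ n)`. -/
def allocation (net : FlowNetwork L K) (n : Fin K → ℕ) (k : Fin K) : ℝ :=
  net.throughput (fun j => net.accessRate j * (n j : ℝ)) k

/-- Transition rates of the numbers of flows: `n → n + e_k` at rate `lambda_k` and
`n → n - e_k` at rate `mu_k * φ_k n` (which vanishes if `n k = 0`).  The diagonal entry is minus the
total rate out of `n`. -/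
def generator (net : FlowNetwork L K) (n m : Fin K → ℕ) : ℝ :=
  if m = n then -∑ k, (net.arrivalRate k + net.serviceRate k * net.allocation n k)
  else ∑ k, ((if m = n + Pi.single k 1 then net.arrivalRate k else 0) +
    (if n = m + Pi.single k 1 then net.serviceRate k * net.allocation n k else 0))

/-- The network with access rates divided by `β`, and with arrival rates and inverse mean flow sizes
multiplied by `β`. -/
def scale (net : FlowNetwork L K) (β : ℕ) (hβ : 0 < β) : FlowNetwork L K where
  capacity := net.capacity
  capacity_pos := net.capacity_pos
  route := net.route
  route_ne_nil := net.route_ne_nil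
  route_nodup := net.route_nodup
  accessRate k := net.accessRate k / β
  accessRate_pos k := div_pos (net.accessRate_pos k) (Nat.cast_pos.2 hβ)
  arrivalRate k := net.arrivalRate k * β
  arrivalRate_nonneg k := mul_nonneg (net.arrivalRate_nonneg k) (Nat.cast_nonneg β)
  serviceRate k := β * net.serviceRate k
  serviceRate_pos k := mul_pos (Nat.cast_pos.2 hβ) (net.serviceRate_pos k)

/-- `X` is a solution on `[0, ∞)`, with values in the nonnegative orthant and initial value `x₀`, of
`dX_k/dt = a_k lambda_k - a_k mu_k ψ_k(X)`. -/
def IsLimitSolution (net : FlowNetwork L K) (x₀ : Fin K → ℝ) (X : ℝ → Fin K → ℝ) : Prop :=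
  X 0 = x₀ ∧ (∀ t, 0 ≤ t → ∀ k, 0 ≤ X t k) ∧
  ∀ t, 0 ≤ t → ∀ k, HasDerivWithinAt (fun s => X s k)
    (net.accessRate k * net.arrivalRate k
      - net.accessRate k * net.serviceRate k * net.throughput (X t) k) (Ici 0) t

end FlowNetwork

/-- A transition function on a countable discrete state space `S` (a semigroup of Markov kernels)
whose derivative at time `0` is the matrix of transition rates `q`. -/
structure IsTransitionFunction {S : Type*} [MeasurableSpace S] [DecidableEq S]
    (q : S → S → ℝ) (p : ℝ≥0 → Kernel S S) : Prop where
  isMarkov : ∀ t, IsMarkovKernel (p t)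
  zero : p 0 = Kernel.id
  add : ∀ s t, p (s + t) = p t ∘ₖ p s
  rate : ∀ i j, Tendsto
    (fun h : ℝ≥0 => ((p h i).real {j} - (if i = j then 1 else 0)) / (h : ℝ)) (𝓝[>] 0) (𝓝 (q i j))

/-- `X` is, on the probability space `(Ω, P)`, a continuous-time Markov process on
the discrete state space `S` with transition rates `q` and càdlàg paths. -/
structure IsMarkovJump {S : Type*} [MeasurableSpace S] [DecidableEq S] [TopologicalSpace S]
    (q : S → S → ℝ) {Ω : Type*} [MeasurableSpace Ω] (P : Measure Ω) (X : ℝ≥0 → Ω → S) : Prop where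
  measurable : ∀ t, Measurable (X t)
  right_continuous : ∀ ω t, ContinuousWithinAt (fun s => X s ω) (Ici t) t
  left_limits : ∀ ω t, ∃ l, Tendsto (fun s => X s ω) (𝓝[<] t) (𝓝 l)
  markov : ∃ p : ℝ≥0 → Kernel S S, IsTransitionFunction q p ∧
    ∀ s t : ℝ≥0, ∀ A : Set S, MeasurableSet A →
      P[(X (s + t) ⁻¹' A).indicator (fun _ => (1 : ℝ)) |
          ⨆ u ≤ s, MeasurableSpace.comap (X u) inferInstance]
        =ᵐ[P] fun ω => (p t (X s ω)).real A

/-- `N` is a process of the numbers of flows in progress in the network `net`. -/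
def FlowNetwork.HasFlowDynamics {L K : ℕ} (net : FlowNetwork L K) {Ω : Type*} [MeasurableSpace Ω]
    (P : Measure Ω) (N : ℝ≥0 → Ω → Fin K → ℕ) : Prop :=
  IsMarkovJump net.generator P N

/-- The rescaled vector `β⁻¹ a ⊙ n`. -/
def FlowNetwork.rescale {L K : ℕ} (net : FlowNetwork L K) (β : ℕ) (n : Fin K → ℕ) : Fin K → ℝ :=
  fun k => (β : ℝ)⁻¹ * (net.accessRate k * (n k : ℝ))

end

/-!
The proof avoids stochastic integrals and unbounded martingales. It follows a bounded Lyapunov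
function of the distance to the fluid limit and applies a maximal inequality to it.

*The allocation.* At a link, a flow of rate `x` leaves with rate `x * C / max R C`, where `x ≤ R`.
This is `1`-Lipschitz in `x` and in `R`. By induction along the order of the links given by
acyclicity, `ψ` is Lipschitz on the nonnegative orthant (`exists_abs_throughput_sub_le`). It is
bounded by the capacities, and `ψ_k(x) ≤ x_k`. Hence the limiting vector field, extended by
`x ↦ max x 0`, is bounded and Lipschitz, has unique global solutions, and preserves the orthant
(`exists_isLimitSolution`, `IsLimitSolution.eq`).

*The transition function.* All rates are bounded by some `Q`. From the derivatives at `0` and the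
Chapman-Kolmogorov equation alone, supermultiplicativity of `t ↦ p t i i` and Bernoulli's inequality
give `p t i i ≥ 1 + t q i i`, and similarly `p t i j ≥ t q i j (1 - Q t)`. As the total mass is `1`,
these lower bounds yield `∫ f d(p h i) ≤ f i + h (q f) i + O(h ^ 2)` for `0 ≤ f ≤ B`, uniformly in `i`
(`IsTransitionFunction.integral_le_add`).

*The Lyapunov function.* Let `V t n = ∑ k, φ (β⁻¹ a_k n_k - X_k t)` with `φ z = z ^ 2 / (1 + z ^ 2)`.
Jumps have size `a_k / β` and rates of order `β`, so by Taylor's formula the generator applied to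
`V t` is the derivative in the direction of the drift, up to `O(1 / β)`. The drift is bounded and
Lipschitz, so its variation is controlled by `∑ j, min 1 |z_j|`, and one obtains
`E V (t + h) ≤ (1 + C h) V t + h b / β + c h ^ 2` with `C` and `b` independent of `β`
(`exists_integral_lyapunov_le`).

*Conclusion.* Along a grid of mesh `h`, a corrected version of `V` is a nonnegative supermartingale,
to which a maximal inequality applies; as `h → 0` the term `c h ^ 2` disappears, and
right-continuity of the paths passes from dyadic grids to all times
(`IsMarkovJump.mul_measure_exists_le`). The resulting bound for
`P (∃ t ≤ T, V t (N t) > δ)` is a constant times `E V 0 + T b / β`, which tends to zero.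
-/

/-! ### Transition functions with bounded rates -/

namespace IsTransitionFunction

variable {S : Type*} [MeasurableSpace S] [DecidableEq S] {q : S → S → ℝ} {p : ℝ≥0 → Kernel S S}

lemma tendsto_rate_div (hp : IsTransitionFunction q p) {t : ℝ≥0} (ht : 0 < t) (i j : S) :
    Tendsto (fun n : ℕ => ((p (t / (n + 1)) i).real {j} - (if i = j then 1 else 0)) /
      ((t : ℝ) / (n + 1))) atTop (𝓝 (q i j)) := by
  have h0 : Tendsto (fun n : ℕ => t / ((n : ℝ≥0) + 1)) atTop (𝓝[>] 0) := by
    refine tendsto_nhdsWithin_iff.2 ⟨?_, Eventually.of_forall fun n => ?_⟩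
    · rw [← NNReal.tendsto_coe]
      push_cast
      exact tendsto_const_div_atTop_nhds_zero_nat (t : ℝ) |>.comp (tendsto_add_atTop_nat 1)
        |>.congr fun n => by simp
    · exact div_pos ht (by positivity)
  refine ((hp.rate i j).comp h0).congr fun n => ?_
  simp

variable [MeasurableSingletonClass S]

/-- One half of the Chapman-Kolmogorov equation, over finitely many intermediate states. -/
lemma sum_mul_le_real_add (hp : IsTransitionFunction q p) (s t : ℝ≥0) (i j : S) (F : Finset S) :
    ∑ l ∈ F, (p s i).real {l} * (p t l).real {j} ≤ (p (s + t) i).real {j} := by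
  have := hp.isMarkov
  have h : ∑ l ∈ F, p s i {l} * p t l {j} ≤ p (s + t) i {j} := by
    rw [hp.add, Kernel.comp_apply' _ _ _ (measurableSet_singleton j)]
    calc ∑ l ∈ F, p s i {l} * p t l {j} = ∫⁻ b in (F : Set S), p t b {j} ∂(p s i) := by
          rw [lintegral_finset]
          exact Finset.sum_congr rfl fun _ _ => mul_comm _ _
      _ ≤ _ := setLIntegral_le_lintegral _ _
  have h' := ENNReal.toReal_mono (measure_ne_top _ _) h
  rw [ENNReal.toReal_sum fun l _ => ENNReal.mul_ne_top (measure_ne_top _ _) (measure_ne_top _ _)]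
    at h'
  simpa only [ENNReal.toReal_mul, measureReal_def] using h'

lemma real_zero (hp : IsTransitionFunction q p) (i j : S) :
    (p 0 i).real {j} = if i = j then 1 else 0 := by
  rw [hp.zero, Kernel.id_apply, measureReal_def, Measure.dirac_apply' _ (measurableSet_singleton j)]
  by_cases h : i = j <;> simp [h]

lemma pow_le_real_nsmul (hp : IsTransitionFunction q p) (h : ℝ≥0) (i : S) (n : ℕ) :
    (p h i).real {i} ^ n ≤ (p (n • h) i).real {i} := by
  induction n with
  | zero => simp [hp.real_zero]
  | succ n ih =>
    rw [succ_nsmul, pow_succ]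
    have := hp.sum_mul_le_real_add (n • h) h i i {i}
    rw [Finset.sum_singleton] at this
    exact (mul_le_mul_of_nonneg_right ih measureReal_nonneg).trans this

/-- Bernoulli's inequality turns the derivative at `0` into a bound for all times, because
`t ↦ p t i i` is supermultiplicative. -/
lemma one_add_mul_le_real_self (hp : IsTransitionFunction q p) (t : ℝ≥0) (i : S) :
    1 + t * q i i ≤ (p t i).real {i} := by
  rcases eq_or_lt_of_le (zero_le (a := t)) with rfl | ht
  · simp [hp.real_zero]
  refine le_of_tendsto' (((hp.tendsto_rate_div ht i i).const_mul (t : ℝ)).const_add 1) fun n => ?_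
  have hn : (0 : ℝ) < n + 1 := by positivity
  have ht' : (0 : ℝ) < t := ht
  have h1 := hp.pow_le_real_nsmul (t / (n + 1)) i (n + 1)
  have h2 : (n + 1) • (t / ((n : ℝ≥0) + 1)) = t := by
    rw [nsmul_eq_mul]; push_cast; field_simp
  rw [h2] at h1
  refine le_trans (le_of_eq ?_) ((one_add_mul_sub_le_pow (n := n + 1) ?_).trans h1)
  · simp only [if_true]
    push_cast
    field_simp
  · linarith [measureReal_nonneg (μ := p (t / (n + 1)) i) (s := {i})]

lemma nsmul_mul_pow_le_real (hp : IsTransitionFunction q p) {c : ℝ} (hc : 0 ≤ c) (h : ℝ≥0)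
    (hself : ∀ i, c ≤ (p h i).real {i}) {i j : S} (hij : i ≠ j) (n : ℕ) :
    (n + 1) * (p h i).real {j} * c ^ n ≤ (p ((n + 1) • h) i).real {j} := by
  induction n with
  | zero => simp
  | succ n ih =>
    have h1 := hp.sum_mul_le_real_add ((n + 1) • h) h i j {i, j}
    rw [Finset.sum_pair hij, ← succ_nsmul] at h1
    refine le_trans ?_ h1
    have h2 : c ^ (n + 1) ≤ (p ((n + 1) • h) i).real {i} :=
      (pow_le_pow_left₀ hc (hself i) _).trans (hp.pow_le_real_nsmul h i (n + 1))
    have h3 := mul_le_mul_of_nonneg_right h2 (measureReal_nonneg (μ := p h i) (s := {j}))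
    have h4 := mul_le_mul ih (hself j) hc measureReal_nonneg
    push_cast
    calc ((n : ℝ) + 1 + 1) * (p h i).real {j} * c ^ (n + 1)
        = c ^ (n + 1) * (p h i).real {j} + (n + 1) * (p h i).real {j} * c ^ n * c := by ring
      _ ≤ _ := add_le_add h3 h4

/-- If the total rates are bounded by `Q`, then `p t i j` is at least the probability that exactly
one jump occurs before `t`, and that it is from `i` to `j`, up to the estimate `1 - Q t` of the
probability of no other jump. -/
lemma mul_rate_le_real (hp : IsTransitionFunction q p) {Q : ℝ} (hQ : ∀ i, -q i i ≤ Q) {i j : S}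
    (hij : i ≠ j) (hq : 0 ≤ q i j) (t : ℝ≥0) : t * q i j * (1 - Q * t) ≤ (p t i).real {j} := by
  rcases eq_or_lt_of_le (zero_le (a := t)) with rfl | ht
  · simp
  have ht' : (0 : ℝ) < t := ht
  rcases le_or_gt (1 - Q * t) 0 with hneg | hpos
  · exact (mul_nonpos_of_nonneg_of_nonpos (by positivity) hneg).trans measureReal_nonneg
  rcases lt_or_ge Q 0 with hQ0 | hQ0
  · have h1 := hp.one_add_mul_le_real_self t i
    have := hp.isMarkov
    have h2 : (p t i).real {i} ≤ 1 := measureReal_le_one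
    have h3 : t * q i i ≤ 0 := by linarith
    have h4 : q i i ≤ 0 := by
      by_contra! h
      exact absurd h3 (not_le.2 (mul_pos ht' h))
    exact absurd (hQ i) (by linarith)
  refine le_of_tendsto' (((hp.tendsto_rate_div ht i j).const_mul (t : ℝ)).mul_const _) fun n => ?_
  have hn : (0 : ℝ) < n + 1 := by positivity
  set h : ℝ≥0 := t / (n + 1) with hh
  have hcoe : (h : ℝ) = t / (n + 1) := by simp [hh]
  have hnh : (n + 1) • h = t := by
    rw [hh, nsmul_eq_mul]; push_cast; field_simp
  have hle : (h : ℝ) ≤ t := by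
    rw [hcoe]; exact div_le_self ht'.le (by linarith [Nat.cast_nonneg (α := ℝ) n])
  have hc : 0 ≤ 1 - Q * h := by nlinarith
  have hc1 : 1 - Q * h ≤ 1 := by nlinarith [h.coe_nonneg]
  have h1 := hp.nsmul_mul_pow_le_real hc h (fun i => by
    refine le_trans ?_ (hp.one_add_mul_le_real_self h i)
    nlinarith [hQ i, h.coe_nonneg]) hij n
  rw [hnh] at h1
  refine le_trans ?_ h1
  have h2 : 1 - Q * t ≤ (1 - Q * h) ^ n := by
    refine le_trans ?_ (pow_le_pow_of_le_one hc hc1 (Nat.le_succ n))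
    have := one_add_mul_le_pow (a := -(Q * h)) (by linarith) (n + 1)
    calc 1 - Q * t = 1 + ((n + 1 : ℕ) : ℝ) * -(Q * h) := by
          rw [hcoe]; push_cast; field_simp; ring
      _ ≤ _ := by simpa [sub_eq_add_neg] using this
  calc _ = (n + 1) * (p h i).real {j} * (1 - Q * t) := by
        simp only [hij, if_false]; field_simp; ring
    _ ≤ _ := mul_le_mul_of_nonneg_left h2 (mul_nonneg hn.le measureReal_nonneg)

/-- First-order expansion of the transition operators on functions with values in `[0, B]`, with
a remainder that is uniform in the initial state `i`. The finite set `F` contains the states that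
can be reached by one jump from `i`. -/
lemma integral_le_add (hp : IsTransitionFunction q p) [Countable S] {Q : ℝ}
    (hQ : ∀ i, -q i i ≤ Q) {i : S} {F : Finset S} (hi : i ∉ F) (hF : ∀ j ∈ F, 0 ≤ q i j)
    (hsum : ∑ j ∈ F, q i j = -q i i) {f : S → ℝ} {B : ℝ} (hf0 : ∀ j, 0 ≤ f j) (hfB : ∀ j, f j ≤ B)
    (h : ℝ≥0) :
    ∫ j, f j ∂(p h i) ≤ f i + h * ∑ j ∈ F, q i j * (f j - f i) + B * Q ^ 2 * h ^ 2 := by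
  have := hp.isMarkov
  have hB : 0 ≤ B := (hf0 i).trans (hfB i)
  have hqi : 0 ≤ -q i i := hsum ▸ Finset.sum_nonneg hF
  have hQ0 : 0 ≤ Q := hqi.trans (hQ i)
  have hh := h.coe_nonneg
  have hint : Integrable f (p h i) :=
    Integrable.of_bound (measurable_of_countable f).aestronglyMeasurable B
      (Eventually.of_forall fun j => by rw [Real.norm_of_nonneg (hf0 j)]; exact hfB j)
  have hint' : Integrable (fun j => B - f j) (p h i) := (integrable_const B).sub hint
  have key : (B - f i) * (1 + h * q i i) + ∑ j ∈ F, (B - f j) * (h * q i j * (1 - Q * h))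
      ≤ ∫ j, (B - f j) ∂(p h i) := by
    calc _ ≤ ∑ j ∈ insert i F, (p h i).real {j} * (B - f j) := by
          rw [Finset.sum_insert hi]
          refine add_le_add ?_ (Finset.sum_le_sum fun j hj => ?_)
          · rw [mul_comm]
            exact mul_le_mul_of_nonneg_right (hp.one_add_mul_le_real_self h i)
              (sub_nonneg.2 (hfB i))
          · rw [mul_comm]
            exact mul_le_mul_of_nonneg_right
              (hp.mul_rate_le_real hQ (ne_of_mem_of_not_mem hj hi).symm (hF j hj) h) (sub_nonneg.2 (hfB j))
      _ = ∫ j in ((insert i F : Finset S) : Set S), (B - f j) ∂(p h i) := by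
          rw [setIntegral_finset _ hint'.integrableOn]
          simp
      _ ≤ _ := setIntegral_le_integral hint'
          (Eventually.of_forall fun j => sub_nonneg.2 (hfB j))
  rw [integral_sub (integrable_const B) hint] at key
  simp only [integral_const, probReal_univ, one_smul] at key
  have e1 : ∑ j ∈ F, (B - f j) * (h * q i j * (1 - Q * h)) =
      h * B * (-q i i) - h * ∑ j ∈ F, q i j * f j - Q * h ^ 2 * ∑ j ∈ F, q i j * (B - f j) := by
    rw [← hsum, Finset.mul_sum, Finset.mul_sum, Finset.mul_sum, ← Finset.sum_sub_distrib,
      ← Finset.sum_sub_distrib]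
    exact Finset.sum_congr rfl fun j _ => by ring
  have e2 : ∑ j ∈ F, q i j * (f j - f i) = ∑ j ∈ F, q i j * f j + q i i * f i := by
    rw [show q i i = -∑ j ∈ F, q i j by rw [hsum]; ring, neg_mul, Finset.sum_mul,
      ← sub_eq_add_neg, ← Finset.sum_sub_distrib]
    exact Finset.sum_congr rfl fun j _ => by ring
  have e3 : ∑ j ∈ F, q i j * (B - f j) ≤ Q * B := by
    calc _ ≤ ∑ j ∈ F, q i j * B :=
          Finset.sum_le_sum fun j hj => mul_le_mul_of_nonneg_left (by linarith [hf0 j]) (hF j hj)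
      _ = -q i i * B := by rw [← Finset.sum_mul, hsum]
      _ ≤ _ := mul_le_mul_of_nonneg_right (hQ i) hB
  have e4 := mul_le_mul_of_nonneg_left e3 (mul_nonneg hQ0 (sq_nonneg (h : ℝ)))
  rw [e1] at key
  rw [e2]
  linarith

end IsTransitionFunction

/-! ### Markov property and a maximal inequality -/

/-- The Markov property for nonnegative functions of the state, from the one for indicators. -/
lemma IsMarkovJump.exists_setLIntegral_eq {S : Type*} [MeasurableSpace S] [DecidableEq S]
    [TopologicalSpace S] {q : S → S → ℝ} {Ω : Type*} [MeasurableSpace Ω] {P : Measure Ω}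
    [IsProbabilityMeasure P] {X : ℝ≥0 → Ω → S} (h : IsMarkovJump q P X) :
    ∃ p : ℝ≥0 → Kernel S S, IsTransitionFunction q p ∧ ∀ (s t : ℝ≥0) (E : Set Ω),
      MeasurableSet[⨆ u ≤ s, MeasurableSpace.comap (X u) inferInstance] E →
      ∀ V : S → ℝ≥0∞, Measurable V →
      ∫⁻ ω in E, V (X (s + t) ω) ∂P = ∫⁻ ω in E, ∫⁻ j, V j ∂(p t (X s ω)) ∂P := by
  obtain ⟨p, htrans, hmarkov⟩ := h.markov
  have hX := h.measurable
  have hp := htrans.isMarkov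
  refine ⟨p, htrans, fun s t E hE V hV => ?_⟩
  have hm : (⨆ u ≤ s, MeasurableSpace.comap (X u) inferInstance) ≤ ‹MeasurableSpace Ω› :=
    iSup₂_le fun u _ => (hX u).comap_le
  have hmeas : (P.restrict E).map (X (s + t)) = ((P.restrict E).map (X s)).bind (p t) := by
    ext A hA
    rw [Measure.map_apply (hX _) hA, Measure.bind_apply hA (p t).aemeasurable,
      lintegral_map ((p t).measurable_coe hA) (hX s),
      Measure.restrict_apply (hX _ hA)]
    have h1 := setIntegral_condExp hm
      (((integrable_const (1 : ℝ)).indicator (hX (s + t) hA)) :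
        Integrable ((X (s + t) ⁻¹' A).indicator fun _ => (1 : ℝ)) P) hE
    rw [setIntegral_congr_ae (hm _ hE) ((hmarkov s t A hA).mono fun ω h _ => h),
      setIntegral_indicator (hX _ hA)] at h1
    simp only [integral_const, smul_eq_mul, mul_one, measureReal_restrict_apply_univ] at h1
    have h2 : ∫⁻ ω in E, p t (X s ω) A ∂P = ENNReal.ofReal (∫ ω in E, (p t (X s ω)).real A ∂P) := by
      rw [ofReal_integral_eq_lintegral_ofReal]
      · exact lintegral_congr fun ω => (ofReal_measureReal).symm
      · refine Integrable.of_bound (C := 1) ?_ (Eventually.of_forall fun ω => ?_)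
        · exact (((p t).measurable_coe hA).comp (hX s)).ennreal_toReal.aestronglyMeasurable
        · rw [Real.norm_of_nonneg measureReal_nonneg]; exact measureReal_le_one
      · exact Eventually.of_forall fun ω => measureReal_nonneg
    rw [h2, h1, ofReal_measureReal, inter_comm]
  calc _ = ∫⁻ x, V x ∂((P.restrict E).map (X (s + t))) := (lintegral_map hV (hX _)).symm
    _ = ∫⁻ y, ∫⁻ j, V j ∂(p t y) ∂((P.restrict E).map (X s)) := by
        rw [hmeas, Measure.lintegral_bind (p t).aemeasurable hV.aemeasurable]
    _ = _ := lintegral_map hV.lintegral_kernel (hX s)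

/-- Maximal inequality for a nonnegative process `V` whose integrals over the events "`V` has
stayed below `δ` so far" do not increase, such as a supermartingale. -/
lemma mul_measure_exists_le_le_lintegral {Ω : Type*} [MeasurableSpace Ω] {P : Measure Ω}
    {V : ℕ → Ω → ℝ≥0∞} (hV : ∀ j, Measurable (V j)) (δ : ℝ≥0∞) (m : ℕ)
    (hstep : ∀ j < m, ∫⁻ ω in {ω | ∀ i ≤ j, V i ω < δ}, V (j + 1) ω ∂P ≤
      ∫⁻ ω in {ω | ∀ i ≤ j, V i ω < δ}, V j ω ∂P) :
    δ * P {ω | ∃ j ≤ m, δ ≤ V j ω} ≤ ∫⁻ ω, V 0 ω ∂P := by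
  have hmeas : ∀ j, MeasurableSet {ω | ∀ i ≤ j, V i ω < δ} := fun j => by
    have : {ω | ∀ i ≤ j, V i ω < δ} = ⋂ i ≤ j, {ω | V i ω < δ} := by ext; simp
    rw [this]
    exact MeasurableSet.iInter fun i => MeasurableSet.iInter fun _ =>
      measurableSet_lt (hV i) measurable_const
  have hsplit : ∀ j, {ω | ∃ i ≤ j, δ ≤ V i ω} = {ω | ∀ i ≤ j, V i ω < δ}ᶜ := fun j => by
    ext; simp
  have key : ∀ j ≤ m, δ * P {ω | ∃ i ≤ j, δ ≤ V i ω} + ∫⁻ ω in {ω | ∀ i ≤ j, V i ω < δ}, V j ω ∂P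
      ≤ ∫⁻ ω, V 0 ω ∂P := by
    intro j
    induction j with
    | zero =>
      intro _
      rw [← lintegral_add_compl (μ := P) (V 0) (hmeas 0), add_comm (δ * _), ← hsplit 0]
      refine add_le_add le_rfl ?_
      rw [← setLIntegral_const]
      exact setLIntegral_mono' (by rw [hsplit]; exact (hmeas 0).compl) fun ω hω => by simpa using hω
    | succ j ih =>
      intro hj
      refine le_trans ?_ (ih (by omega))
      have hunion : {ω | ∃ i ≤ j + 1, δ ≤ V i ω} = {ω | ∃ i ≤ j, δ ≤ V i ω} ∪
          ({ω | ∀ i ≤ j, V i ω < δ} ∩ {ω | δ ≤ V (j + 1) ω}) := by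
        ext ω
        simp only [mem_ofPred_eq, mem_union, mem_inter_iff]
        constructor
        · rintro ⟨i, hi, h⟩
          by_cases hex : ∃ i ≤ j, δ ≤ V i ω
          · exact Or.inl hex
          · push Not at hex
            rcases Nat.lt_or_ge j i with h1 | h1
            · obtain rfl : i = j + 1 := by omega
              exact Or.inr ⟨hex, h⟩
            · exact absurd h (not_le.2 (hex i h1))
        · rintro (⟨i, hi, h⟩ | ⟨-, h⟩)
          · exact ⟨i, by omega, h⟩
          · exact ⟨j + 1, le_rfl, h⟩
      have hinter : {ω | ∀ i ≤ j + 1, V i ω < δ} =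
          {ω | ∀ i ≤ j, V i ω < δ} ∩ {ω | δ ≤ V (j + 1) ω}ᶜ := by
        ext ω
        simp only [mem_ofPred_eq, mem_inter_iff, mem_compl_iff, not_le]
        constructor
        · exact fun h => ⟨fun i hi => h i (by omega), h _ le_rfl⟩
        · rintro ⟨h1, h2⟩ i hi
          rcases Nat.lt_or_ge j i with h3 | h3
          · obtain rfl : i = j + 1 := by omega
            exact h2
          · exact h1 i h3
      have hle : MeasurableSet {ω | δ ≤ V (j + 1) ω} := measurableSet_le measurable_const (hV _)
      refine le_trans ?_ (add_le_add_right (hstep j (by omega)) _)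
      rw [← lintegral_inter_add_sdiff (V (j + 1)) {ω | ∀ i ≤ j, V i ω < δ} hle, hinter, ← Set.sdiff_eq,
        ← add_assoc]
      gcongr
      calc δ * P {ω | ∃ i ≤ j + 1, δ ≤ V i ω}
          ≤ δ * (P {ω | ∃ i ≤ j, δ ≤ V i ω} +
            P ({ω | ∀ i ≤ j, V i ω < δ} ∩ {ω | δ ≤ V (j + 1) ω})) := by
            rw [hunion]; gcongr; exact measure_union_le _ _
        _ = δ * P {ω | ∃ i ≤ j, δ ≤ V i ω} +
            δ * P ({ω | ∀ i ≤ j, V i ω < δ} ∩ {ω | δ ≤ V (j + 1) ω}) := mul_add _ _ _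
        _ ≤ _ := by
            gcongr
            rw [← setLIntegral_const]
            exact setLIntegral_mono' ((hmeas j).inter hle) fun ω hω => hω.2
  exact le_self_add.trans (key m le_rfl)

/-! ### The bandwidth allocation -/

namespace FlowNetwork

variable {L K : ℕ} {net : FlowNetwork L K}

lemma passRatio_eq_div_max {C : ℝ} (hC : 0 < C) (R : ℝ) : passRatio C R = C / max R C := by
  unfold passRatio
  split_ifs with h
  · rw [max_eq_right h, div_self hC.ne']
  · rw [max_eq_left (not_le.1 h).le]

lemma passRatio_nonneg {C : ℝ} (hC : 0 < C) (R : ℝ) : 0 ≤ passRatio C R := by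
  rw [passRatio_eq_div_max hC]
  exact div_nonneg hC.le (hC.le.trans (le_max_right _ _))

lemma passRatio_le_one {C : ℝ} (hC : 0 < C) (R : ℝ) : passRatio C R ≤ 1 := by
  rw [passRatio_eq_div_max hC]
  exact div_le_one_of_le₀ (le_max_right _ _) (hC.le.trans (le_max_right _ _))

/-- A flow of rate `x ≤ R` leaves the link with a rate that is Lipschitz in `x` and `R`: the slope
`C / R ^ 2` of the pass ratio is compensated by the factor `x`. -/
lemma abs_mul_passRatio_sub_le {C : ℝ} (hC : 0 < C) {x y R S : ℝ} (hy : 0 ≤ y) (hyS : y ≤ S) :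
    |x * passRatio C R - y * passRatio C S| ≤ |x - y| + |R - S| := by
  have hR : 0 < max R C := hC.trans_le (le_max_right _ _)
  have hS : 0 < max S C := hC.trans_le (le_max_right _ _)
  have e : x * passRatio C R - y * passRatio C S =
      (x - y) * passRatio C R + y * (passRatio C R - passRatio C S) := by ring
  rw [e]
  refine (abs_add_le _ _).trans (add_le_add ?_ ?_)
  · rw [abs_mul, abs_of_nonneg (passRatio_nonneg hC R)]
    exact mul_le_of_le_one_right (abs_nonneg _) (passRatio_le_one hC R)
  · have e2 : y * (passRatio C R - passRatio C S) =
        (y / max S C) * (C / max R C) * (max S C - max R C) := by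
      rw [passRatio_eq_div_max hC, passRatio_eq_div_max hC]
      field_simp
    rw [e2, abs_mul, abs_of_nonneg (mul_nonneg (div_nonneg hy hS.le) (div_nonneg hC.le hR.le))]
    have h1 : y / max S C ≤ 1 := div_le_one_of_le₀ (hyS.trans (le_max_left _ _)) hS.le
    have h2 : C / max R C ≤ 1 := div_le_one_of_le₀ (le_max_right _ _) hR.le
    have h3 : |max S C - max R C| ≤ |R - S| := by
      rw [abs_sub_comm R S]
      exact abs_max_sub_max_le_abs S R C
    calc _ ≤ 1 * |max S C - max R C| :=
          mul_le_mul_of_nonneg_right (mul_le_one₀ h1 (div_nonneg hC.le hR.le) h2) (abs_nonneg _)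
      _ ≤ _ := by rwa [one_mul]

namespace IsTailDropping

variable {x : Fin K → ℝ} {θ : Fin K → ℕ → ℝ}

lemma nonneg (h : net.IsTailDropping x θ) (hx : ∀ k, 0 ≤ x k) (k : Fin K) (i : ℕ)
    (hi : i ≤ (net.route k).length) : 0 ≤ θ k i := by
  induction i with
  | zero => rw [h.1]; exact hx k
  | succ i ih =>
    rw [h.2 k ⟨i, hi⟩]
    exact mul_nonneg (ih (by omega)) (passRatio_nonneg (net.capacity_pos _) _)

lemma le_input (h : net.IsTailDropping x θ) (hx : ∀ k, 0 ≤ x k) (k : Fin K) (i : ℕ)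
    (hi : i ≤ (net.route k).length) : θ k i ≤ x k := by
  induction i with
  | zero => rw [h.1]
  | succ i ih =>
    rw [h.2 k ⟨i, hi⟩]
    exact (mul_le_of_le_one_right (h.nonneg hx k i (by omega))
      (passRatio_le_one (net.capacity_pos _) _)).trans (ih (by omega))

lemma le_inputRate (h : net.IsTailDropping x θ) (hx : ∀ k, 0 ≤ x k) (k : Fin K)
    (i : Fin (net.route k).length) : θ k i ≤ net.inputRate θ (net.route k)[i] := by
  have h0 : ∀ k', ∀ i' : Fin (net.route k').length,
      0 ≤ if (net.route k')[i'] = (net.route k)[i] then θ k' i' else 0 := fun k' i' => by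
    split_ifs
    · exact h.nonneg hx k' i' i'.2.le
    · exact le_rfl
  unfold inputRate
  refine le_trans ?_ (Finset.single_le_sum
    (f := fun k' => ∑ i' : Fin (net.route k').length,
      if (net.route k')[i'] = (net.route k)[i] then θ k' i' else 0)
    (fun k' _ => Finset.sum_nonneg fun i' _ => h0 k' i') (Finset.mem_univ k))
  refine le_trans (le_of_eq ?_) (Finset.single_le_sum (fun i' _ => h0 k i') (Finset.mem_univ i))
  simp

lemma le_capacity (h : net.IsTailDropping x θ) (hx : ∀ k, 0 ≤ x k) (k : Fin K)
    (i : Fin (net.route k).length) : θ k (i + 1) ≤ net.capacity (net.route k)[i] := by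
  have hC := net.capacity_pos (net.route k)[i]
  rw [h.2 k i, passRatio_eq_div_max hC, mul_div_assoc', div_le_iff₀ (hC.trans_le (le_max_right _ _)),
    mul_comm]
  exact mul_le_mul_of_nonneg_left ((h.le_inputRate hx k i).trans (le_max_left _ _)) hC.le

/-- Lipschitz dependence on the input rates, link by link in the order given by the acyclicity. -/
lemma abs_sub_le (hnet : net.IsAcyclic) {y : Fin K → ℝ} {η : Fin K → ℕ → ℝ}
    (h : net.IsTailDropping x θ) (h' : net.IsTailDropping y η)
    (hy : ∀ k, 0 ≤ y k) (k : Fin K) (i : ℕ) (hi : i ≤ (net.route k).length) :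
    |θ k i - η k i| ≤ (1 + ∑ k, ((net.route k).length : ℝ)) ^ L * ∑ j, |x j - y j| := by
  obtain ⟨σ, hσ⟩ := hnet
  set M : ℝ := ∑ k, ((net.route k).length : ℝ) with hM
  set D : ℝ := ∑ j, |x j - y j| with hD
  have hM0 : 0 ≤ M := Finset.sum_nonneg fun _ _ => Nat.cast_nonneg _
  have hD0 : 0 ≤ D := Finset.sum_nonneg fun _ _ => abs_nonneg _
  have base : ∀ n k, |θ k 0 - η k 0| ≤ (1 + M) ^ n * D := fun n k => by
    rw [h.1, h'.1]
    exact (Finset.single_le_sum (f := fun j => |x j - y j|) (fun _ _ => abs_nonneg _)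
      (Finset.mem_univ k)).trans (le_mul_of_one_le_left hD0 (one_le_pow₀ (by linarith)))
  have key : ∀ n : ℕ, ∀ k i, i ≤ (net.route k).length →
      (∀ j (hj : j < (net.route k).length), j < i → (σ ((net.route k)[j]) : ℕ) < n) →
      |θ k i - η k i| ≤ (1 + M) ^ n * D := by
    intro n
    induction n with
    | zero =>
      intro k i hi hlt
      rcases i with _ | i
      · exact base 0 k
      · exact absurd (hlt i (by omega) (by omega)) (by omega)
    | succ n ih =>
      intro k i hi hlt
      rcases i with _ | i
      · exact base _ k
      have hσi : (σ ((net.route k)[i]) : ℕ) < n + 1 := hlt i (by omega) (by omega)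
      have prev : ∀ k' i' (hi' : i' < (net.route k').length),
          (σ ((net.route k')[i']) : ℕ) < n + 1 → |θ k' i' - η k' i'| ≤ (1 + M) ^ n * D := by
        intro k' i' hi' hs
        refine ih k' i' hi'.le fun j hj hji => ?_
        have : (σ ((net.route k')[j]) : ℕ) < σ ((net.route k')[i']) :=
          List.pairwise_iff_getElem.1 (hσ k') j i' hj hi' hji
        omega
      have hB : 0 ≤ (1 + M) ^ n * D := by positivity
      have eR : |net.inputRate θ (net.route k)[i] - net.inputRate η (net.route k)[i]|
          ≤ M * ((1 + M) ^ n * D) := by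
        unfold inputRate
        rw [← Finset.sum_sub_distrib, hM, Finset.sum_mul]
        refine (Finset.abs_sum_le_sum_abs _ _).trans (Finset.sum_le_sum fun k' _ => ?_)
        rw [← Finset.sum_sub_distrib]
        refine (Finset.abs_sum_le_sum_abs _ _).trans ?_
        refine (Finset.sum_le_card_nsmul _ _ ((1 + M) ^ n * D) fun i' _ => ?_).trans ?_
        · split_ifs with hc
          · refine prev k' i' i'.2 ?_
            have hc' : (net.route k')[(i' : ℕ)] = (net.route k)[i] := hc
            rw [hc']; exact hσi
          · simpa using hB
        · simp [hM]
      have e1 := h.2 k ⟨i, hi⟩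
      have e2 := h'.2 k ⟨i, hi⟩
      simp only [Fin.getElem_fin] at e1 e2
      rw [e1, e2]
      refine (abs_mul_passRatio_sub_le (net.capacity_pos _) (h'.nonneg hy k i (by omega))
        (h'.le_inputRate hy k ⟨i, hi⟩)).trans ?_
      refine (add_le_add (prev k i hi hσi) eR).trans (le_of_eq ?_)
      ring
  exact key L k i hi fun j hj _ => (σ _).2

end IsTailDropping

lemma throughput_nonneg (hnet : net.IsAcyclic) {x : Fin K → ℝ} (hx : ∀ k, 0 ≤ x k) (k : Fin K) :
    0 ≤ net.throughput x k := by
  obtain ⟨θ, h⟩ := exists_isTailDropping hnet x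
  rw [throughput_eq hnet h]
  exact h.nonneg hx k _ le_rfl

lemma throughput_le (hnet : net.IsAcyclic) {x : Fin K → ℝ} (hx : ∀ k, 0 ≤ x k) (k : Fin K) :
    net.throughput x k ≤ x k := by
  obtain ⟨θ, h⟩ := exists_isTailDropping hnet x
  rw [throughput_eq hnet h]
  exact h.le_input hx k _ le_rfl

lemma throughput_le_sum_capacity (hnet : net.IsAcyclic) {x : Fin K → ℝ} (hx : ∀ k, 0 ≤ x k)
    (k : Fin K) : net.throughput x k ≤ ∑ l, net.capacity l := by
  obtain ⟨θ, h⟩ := exists_isTailDropping hnet x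
  rw [throughput_eq hnet h]
  have hpos := List.length_pos_iff.2 (net.route_ne_nil k)
  have := h.le_capacity hx k ⟨(net.route k).length - 1, by omega⟩
  rw [Nat.sub_add_cancel hpos] at this
  exact this.trans (Finset.single_le_sum (fun l _ => (net.capacity_pos l).le) (Finset.mem_univ _))

lemma exists_abs_throughput_sub_le (hnet : net.IsAcyclic) :
    ∃ D, 0 ≤ D ∧ ∀ x y : Fin K → ℝ, (∀ k, 0 ≤ x k) → (∀ k, 0 ≤ y k) → ∀ k,
      |net.throughput x k - net.throughput y k| ≤ D * ∑ j, |x j - y j| := by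
  refine ⟨(1 + ∑ k, ((net.route k).length : ℝ)) ^ L, by positivity, fun x y _ hy k => ?_⟩
  obtain ⟨θ, h⟩ := exists_isTailDropping hnet x
  obtain ⟨η, h'⟩ := exists_isTailDropping hnet y
  rw [throughput_eq hnet h, throughput_eq hnet h']
  exact h.abs_sub_le hnet h' hy k _ le_rfl

/-! ### The transition rates of the numbers of flows -/

lemma allocation_nonneg (hnet : net.IsAcyclic) (n : Fin K → ℕ) (k : Fin K) :
    0 ≤ net.allocation n k :=
  throughput_nonneg hnet (fun j => mul_nonneg (net.accessRate_pos j).le (Nat.cast_nonneg _)) k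

lemma allocation_le (hnet : net.IsAcyclic) (n : Fin K → ℕ) (k : Fin K) :
    net.allocation n k ≤ ∑ l, net.capacity l :=
  throughput_le_sum_capacity hnet
    (fun j => mul_nonneg (net.accessRate_pos j).le (Nat.cast_nonneg _)) k

lemma allocation_eq_zero (hnet : net.IsAcyclic) {n : Fin K → ℕ} {k : Fin K} (hn : n k = 0) :
    net.allocation n k = 0 := by
  refine le_antisymm ?_ (allocation_nonneg hnet n k)
  refine (throughput_le hnet
    (fun j => mul_nonneg (net.accessRate_pos j).le (Nat.cast_nonneg _)) k).trans ?_
  simp [hn]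

lemma neg_generator_self_le (hnet : net.IsAcyclic) (n : Fin K → ℕ) :
    -net.generator n n ≤ ∑ k, (net.arrivalRate k + net.serviceRate k * ∑ l, net.capacity l) := by
  rw [generator, if_pos rfl, neg_neg]
  exact Finset.sum_le_sum fun k _ => add_le_add le_rfl
    (mul_le_mul_of_nonneg_left (allocation_le hnet n k) (net.serviceRate_pos k).le)

/-- The off-diagonal part of the generator as a sum over arrivals and departures. The truncated
subtraction in `n - e_k` is harmless, since departures have rate zero when `n k = 0`. -/
lemma exists_sum_generator_mul (hnet : net.IsAcyclic) (n : Fin K → ℕ) :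
    ∃ F : Finset (Fin K → ℕ), n ∉ F ∧ (∀ m ∈ F, 0 ≤ net.generator n m) ∧
      ∀ g : (Fin K → ℕ) → ℝ, ∑ m ∈ F, net.generator n m * g m =
        ∑ k, (net.arrivalRate k * g (n + Pi.single k 1) +
          net.serviceRate k * net.allocation n k * g (n - Pi.single k 1)) := by
  have hne : ∀ k, n + Pi.single k 1 ≠ n := fun k e => by
    have := congrFun e k
    simp at this
  have hne' : ∀ k, n k ≠ 0 → n - Pi.single k 1 ≠ n := fun k hk e => by
    have := congrFun e k
    simp at this
    omega
  have hsub : ∀ k m, n = m + Pi.single k 1 ↔ n k ≠ 0 ∧ n - Pi.single k 1 = m := fun k m => by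
    constructor
    · rintro rfl
      exact ⟨by simp, by simp⟩
    · rintro ⟨h, rfl⟩
      ext j
      rcases eq_or_ne j k with rfl | hj
      · simp; omega
      · simp [hj]
  set F := Finset.univ.image (fun k => n + Pi.single k 1) ∪
    (Finset.univ.filter fun k => n k ≠ 0).image (fun k => n - Pi.single k 1) with hF
  have hnF : n ∉ F := by
    simp only [hF, Finset.mem_union, Finset.mem_image, Finset.mem_univ, Finset.mem_filter,
      true_and, not_or, not_exists, not_and]
    exact ⟨hne, hne'⟩
  refine ⟨F, hnF, fun m hm => ?_, fun g => ?_⟩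
  · rw [generator, if_neg (ne_of_mem_of_not_mem hm hnF)]
    refine Finset.sum_nonneg fun k _ => ?_
    have h1 := net.arrivalRate_nonneg k
    have h2 := mul_nonneg (net.serviceRate_pos k).le (allocation_nonneg hnet n k)
    split_ifs <;> linarith
  · calc ∑ m ∈ F, net.generator n m * g m
        = ∑ m ∈ F, ∑ k, ((if m = n + Pi.single k 1 then net.arrivalRate k * g m else 0) +
          (if n = m + Pi.single k 1 then net.serviceRate k * net.allocation n k * g m else 0)) := by
          refine Finset.sum_congr rfl fun m hm => ?_
          rw [generator, if_neg (ne_of_mem_of_not_mem hm hnF), Finset.sum_mul]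
          refine Finset.sum_congr rfl fun k _ => ?_
          rw [add_mul, ite_mul, ite_mul, zero_mul]
      _ = _ := by
          rw [Finset.sum_comm]
          refine Finset.sum_congr rfl fun k _ => ?_
          rw [Finset.sum_add_distrib, Finset.sum_ite_eq', if_pos (by simp [hF])]
          congr 1
          by_cases hk : n k = 0
          · rw [allocation_eq_zero hnet hk]
            simp
          · simp only [hsub, hk, ne_eq, not_false_eq_true, true_and]
            rw [Finset.sum_ite_eq, if_pos]
            refine Finset.mem_union_right _ (Finset.mem_image.2 ⟨k, ?_, rfl⟩)
            simpa using hk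

/-- One-step estimate for the mean of a bounded function of the numbers of flows. -/
lemma integral_transition_le (hnet : net.IsAcyclic) {p : ℝ≥0 → Kernel (Fin K → ℕ) (Fin K → ℕ)}
    (hp : IsTransitionFunction net.generator p) {f : (Fin K → ℕ) → ℝ} {B : ℝ}
    (hf0 : ∀ n, 0 ≤ f n) (hfB : ∀ n, f n ≤ B) (n : Fin K → ℕ) (h : ℝ≥0) :
    ∫ m, f m ∂(p h n) ≤ f n +
      h * ∑ k, (net.arrivalRate k * (f (n + Pi.single k 1) - f n) +
        net.serviceRate k * net.allocation n k * (f (n - Pi.single k 1) - f n)) +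
      B * (∑ k, (net.arrivalRate k + net.serviceRate k * ∑ l, net.capacity l)) ^ 2 * h ^ 2 := by
  obtain ⟨F, hn, hF, hsum⟩ := exists_sum_generator_mul hnet n
  rw [← hsum fun m => f m - f n]
  refine hp.integral_le_add (neg_generator_self_le hnet) hn hF ?_ hf0 hfB h
  have := hsum fun _ => 1
  simp only [mul_one] at this
  rw [this, generator, if_pos rfl, neg_neg]

lemma IsAcyclic.scale (hnet : net.IsAcyclic) {β : ℕ} (hβ : 0 < β) : (net.scale β hβ).IsAcyclic :=
  hnet

lemma allocation_scale {β : ℕ} (hβ : 0 < β) (n : Fin K → ℕ) :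
    (net.scale β hβ).allocation n = net.throughput (net.rescale β n) := by
  have : (fun j => net.accessRate j / β * (n j : ℝ)) = net.rescale β n := by
    ext j
    simp only [rescale]
    ring
  rw [← this]
  rfl

end FlowNetwork

/-! ### The limiting differential equation -/

/-- A bounded Lipschitz vector field has a global forward solution: the Picard-Lindelöf theorem
applies on every interval `[0, n + 1]`, and the solutions agree by uniqueness. -/
lemma exists_global_solution {E : Type*} [NormedAddCommGroup E] [NormedSpace ℝ E] [CompleteSpace E]
    {v : E → E} {D M : ℝ≥0} (hv : LipschitzWith D v) (hM : ∀ x, ‖v x‖ ≤ M) (x₀ : E) :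
    ∃ α : ℝ → E, α 0 = x₀ ∧ ∀ t, 0 ≤ t → HasDerivWithinAt α (v (α t)) (Ici 0) t := by
  have hloc : ∀ n : ℕ, ∃ α : ℝ → E, α 0 = x₀ ∧
      ∀ t ∈ Icc (0 : ℝ) (n + 1), HasDerivWithinAt α (v (α t)) (Icc (0 : ℝ) (n + 1)) t := fun n => by
    have hn : (0 : ℝ) ≤ n + 1 := by positivity
    have := IsPicardLindelof.of_time_independent (f := v) (t₀ := ⟨(0 : ℝ), ⟨le_rfl, hn⟩⟩)
      (x₀ := x₀) (a := M * (n + 1)) (r := 0) (L := M) (K := D) (fun x _ => hM x)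
      hv.lipschitzOnWith (by simp [hn])
    exact this.exists_eq_forall_mem_Icc_hasDerivWithinAt₀
  choose α hα0 hα using hloc
  have hagree : ∀ m n : ℕ, m ≤ n → ∀ t ∈ Icc (0 : ℝ) (m + 1), α m t = α n t := by
    intro m n hmn
    have hmn' : (m : ℝ) ≤ n := Nat.cast_le.2 hmn
    have hsub : Icc (0 : ℝ) (m + 1) ⊆ Icc (0 : ℝ) (n + 1) := Icc_subset_Icc_right (by linarith)
    have hright : ∀ l : ℕ, ∀ t ∈ Ico (0 : ℝ) (l + 1),
        HasDerivWithinAt (α l) (v (α l t)) (Ici t) t := fun l t ht =>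
      (hα l t (Ico_subset_Icc_self ht)).mono_of_mem_nhdsWithin
        (mem_of_superset (Icc_mem_nhdsGE ht.2) (Icc_subset_Icc_left ht.1))
    refine ODE_solution_unique (v := fun _ => v) (fun _ => hv)
      (fun t ht => (hα m t ht).continuousWithinAt) (hright m)
      (fun t ht => ((hα n t (hsub ht)).continuousWithinAt).mono hsub)
      (fun t ht => hright n t ⟨ht.1, ht.2.trans_le (by linarith)⟩) ?_
    rw [hα0, hα0]
  refine ⟨fun t => α ⌊t⌋₊ t, by simp [hα0], fun t ht => ?_⟩
  have hlt : t < ⌊t⌋₊ + 1 := Nat.lt_floor_add_one t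
  have hmem : Icc (0 : ℝ) (⌊t⌋₊ + 1) ∈ 𝓝[Ici 0] t := by
    rw [← Ici_inter_Iic]
    exact inter_mem_nhdsWithin _ (Iic_mem_nhds hlt)
  refine ((hα ⌊t⌋₊ t ⟨ht, hlt.le⟩).mono_of_mem_nhdsWithin hmem).congr_of_eventuallyEq ?_ rfl
  have hmem' : Ici (0 : ℝ) ∩ Iio (⌊t⌋₊ + 1 : ℝ) ∈ 𝓝[Ici 0] t :=
    inter_mem_nhdsWithin _ (Iio_mem_nhds hlt)
  filter_upwards [hmem'] with s hs
  have hs1 : ⌊s⌋₊ ≤ ⌊t⌋₊ := Nat.lt_succ_iff.1 ((Nat.floor_lt hs.1).2 (by push_cast; exact hs.2))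
  exact hagree _ _ hs1 s ⟨hs.1, (Nat.lt_floor_add_one s).le⟩

namespace FlowNetwork

variable {L K : ℕ} {net : FlowNetwork L K}

/-- The right-hand side of the limiting differential equation. -/
noncomputable def fluidDrift (net : FlowNetwork L K) (x : Fin K → ℝ) (k : Fin K) : ℝ :=
  net.accessRate k * net.arrivalRate k
    - net.accessRate k * net.serviceRate k * net.throughput x k

lemma exists_fluidDrift_bound (hnet : net.IsAcyclic) :
    ∃ M, 0 ≤ M ∧ ∀ x : Fin K → ℝ, (∀ k, 0 ≤ x k) → ∀ k, |net.fluidDrift x k| ≤ M := by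
  refine ⟨∑ k, (net.accessRate k * net.arrivalRate k +
    net.accessRate k * net.serviceRate k * ∑ l, net.capacity l), ?_, fun x hx k => ?_⟩
  all_goals
    have hnn : ∀ k, 0 ≤ net.accessRate k * net.arrivalRate k ∧
        0 ≤ net.accessRate k * net.serviceRate k := fun k =>
      ⟨mul_nonneg (net.accessRate_pos k).le (net.arrivalRate_nonneg k),
        mul_nonneg (net.accessRate_pos k).le (net.serviceRate_pos k).le⟩
    have hC : 0 ≤ ∑ l, net.capacity l := Finset.sum_nonneg fun l _ => (net.capacity_pos l).le
    have hterm : ∀ k, 0 ≤ net.accessRate k * net.arrivalRate k +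
        net.accessRate k * net.serviceRate k * ∑ l, net.capacity l := fun k =>
      add_nonneg (hnn k).1 (mul_nonneg (hnn k).2 hC)
  · exact Finset.sum_nonneg fun k _ => hterm k
  · refine le_trans ?_ (Finset.single_le_sum (fun k _ => hterm k) (Finset.mem_univ k))
    have h1 := mul_nonneg (hnn k).2 (throughput_nonneg hnet hx k)
    have h2 := mul_le_mul_of_nonneg_left (throughput_le_sum_capacity hnet hx k) (hnn k).2
    rw [fluidDrift, abs_le]
    constructor <;> linarith [(hnn k).1]

lemma exists_abs_fluidDrift_sub_le (hnet : net.IsAcyclic) :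
    ∃ D, 0 ≤ D ∧ ∀ x y : Fin K → ℝ, (∀ k, 0 ≤ x k) → (∀ k, 0 ≤ y k) → ∀ k,
      |net.fluidDrift x k - net.fluidDrift y k| ≤ D * ∑ j, |x j - y j| := by
  obtain ⟨D, hD, h⟩ := exists_abs_throughput_sub_le hnet
  have hnn : ∀ k, 0 ≤ net.accessRate k * net.serviceRate k := fun k =>
    mul_nonneg (net.accessRate_pos k).le (net.serviceRate_pos k).le
  refine ⟨(∑ k, net.accessRate k * net.serviceRate k) * D,
    mul_nonneg (Finset.sum_nonneg fun k _ => hnn k) hD, fun x y hx hy k => ?_⟩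
  have e : net.fluidDrift x k - net.fluidDrift y k =
      -(net.accessRate k * net.serviceRate k * (net.throughput x k - net.throughput y k)) := by
    rw [fluidDrift, fluidDrift]; ring
  rw [e, abs_neg, abs_mul, abs_of_nonneg (hnn k), mul_assoc (Finset.sum _ _)]
  exact mul_le_mul (Finset.single_le_sum (fun k _ => hnn k) (Finset.mem_univ k)) (h x y hx hy k)
    (abs_nonneg _) (Finset.sum_nonneg fun k _ => hnn k)

/-- The drift extended from the nonnegative orthant to the whole space, on which it is bounded and
Lipschitz. -/
lemma exists_lipschitzWith_fluidDrift_max (hnet : net.IsAcyclic) :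
    ∃ D M : ℝ≥0, LipschitzWith D (fun x : Fin K → ℝ => net.fluidDrift fun k => max (x k) 0) ∧
      ∀ x : Fin K → ℝ, ‖net.fluidDrift fun k => max (x k) 0‖ ≤ M := by
  obtain ⟨D, hD, hlip⟩ := exists_abs_fluidDrift_sub_le hnet
  obtain ⟨M, hM, hbound⟩ := exists_fluidDrift_bound hnet
  refine ⟨(D * K).toNNReal, M.toNNReal, LipschitzWith.of_dist_le_mul fun x y => ?_, fun x => ?_⟩
  · rw [Real.coe_toNNReal _ (by positivity)]
    refine (dist_pi_le_iff (by positivity)).2 fun k => ?_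
    rw [Real.dist_eq]
    refine (hlip _ _ (fun _ => le_max_right _ _) (fun _ => le_max_right _ _) k).trans ?_
    rw [mul_assoc]
    refine mul_le_mul_of_nonneg_left ?_ hD
    calc ∑ j, |max (x j) 0 - max (y j) 0| ≤ ∑ _j : Fin K, dist x y :=
          Finset.sum_le_sum fun j _ => (abs_max_sub_max_le_abs _ _ _).trans (dist_le_pi_dist x y j)
      _ = K * dist x y := by simp
  · rw [Real.coe_toNNReal _ hM]
    exact (pi_norm_le_iff_of_nonneg hM).2 fun k => hbound _ (fun _ => le_max_right _ _) k

lemma fluidDrift_nonneg_of_eq_zero (hnet : net.IsAcyclic) {x : Fin K → ℝ} (hx : ∀ k, 0 ≤ x k)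
    {k : Fin K} (hk : x k = 0) : 0 ≤ net.fluidDrift x k := by
  have : net.throughput x k = 0 :=
    le_antisymm ((throughput_le hnet hx k).trans hk.le) (throughput_nonneg hnet hx k)
  rw [fluidDrift, this, mul_zero, sub_zero]
  exact mul_nonneg (net.accessRate_pos k).le (net.arrivalRate_nonneg k)

lemma IsLimitSolution.hasDerivWithinAt {x₀ : Fin K → ℝ} {X : ℝ → Fin K → ℝ}
    (h : net.IsLimitSolution x₀ X) {t : ℝ} (ht : 0 ≤ t) :
    HasDerivWithinAt X (net.fluidDrift (X t)) (Ici 0) t :=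
  hasDerivWithinAt_pi.2 fun k => h.2.2 t ht k

lemma exists_isLimitSolution (hnet : net.IsAcyclic) {x₀ : Fin K → ℝ} (hx₀ : ∀ k, 0 ≤ x₀ k) :
    ∃ X, net.IsLimitSolution x₀ X := by
  obtain ⟨D, M, hlip, hM⟩ := exists_lipschitzWith_fluidDrift_max hnet
  obtain ⟨X, hX0, hX⟩ := exists_global_solution hlip hM x₀
  have hder : ∀ t, 0 ≤ t → ∀ k, HasDerivWithinAt (fun s => X s k)
      (net.fluidDrift (fun j => max (X t j) 0) k) (Ici 0) t := fun t ht k =>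
    hasDerivWithinAt_pi.1 (hX t ht) k
  -- The coordinate `-X k` stays below the barrier `ε (t + 1)`, at which it is nonincreasing.
  have hnn : ∀ t, 0 ≤ t → ∀ k, 0 ≤ X t k := by
    intro t ht k
    have hbar : ∀ ε : ℝ, 0 < ε → -X t k ≤ ε * (t + 1) := fun ε hε => by
      refine image_le_of_deriv_right_lt_deriv_boundary (a := 0) (b := t)
        (f := fun s => -X s k) (f' := fun s => -net.fluidDrift (fun j => max (X s j) 0) k)
        (B := fun s => ε * (s + 1)) (B' := fun _ => ε) ?_ ?_ ?_ ?_ ?_ ⟨ht, le_rfl⟩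
      · exact fun s hs => ((hder s hs.1 k).continuousWithinAt.mono Icc_subset_Ici_self).neg
      · exact fun s hs => ((hder s hs.1 k).mono (Ici_subset_Ici.2 hs.1)).neg
      · simp only [hX0, zero_add, mul_one]
        linarith [hx₀ k]
      · intro s
        simpa using ((hasDerivAt_id s).add_const 1).const_mul ε
      · intro s hs heq
        have hneg : X s k ≤ 0 := by
          have : 0 ≤ ε * (s + 1) := mul_nonneg hε.le (by linarith [hs.1])
          linarith
        have := fluidDrift_nonneg_of_eq_zero hnet (x := fun j => max (X s j) 0) (k := k)
          (fun _ => le_max_right _ _) (max_eq_right hneg)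
        linarith
    have hlim : Tendsto (fun ε : ℝ => ε * (t + 1)) (𝓝[>] 0) (𝓝 0) := by
      have : Tendsto (fun ε : ℝ => ε * (t + 1)) (𝓝 0) (𝓝 (0 * (t + 1))) :=
        tendsto_id.mul_const _
      rw [zero_mul] at this
      exact this.mono_left nhdsWithin_le_nhds
    have := ge_of_tendsto hlim (eventually_mem_nhdsWithin.mono fun ε hε => hbar ε hε)
    linarith
  refine ⟨X, hX0, hnn, fun t ht k => ?_⟩
  have := hder t ht k
  rwa [show (fun j => max (X t j) 0) = X t from funext fun j => max_eq_left (hnn t ht j)] at this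

lemma IsLimitSolution.eq (hnet : net.IsAcyclic) {x₀ : Fin K → ℝ} {X Y : ℝ → Fin K → ℝ}
    (hX : net.IsLimitSolution x₀ X) (hY : net.IsLimitSolution x₀ Y) {t : ℝ} (ht : 0 ≤ t) :
    Y t = X t := by
  obtain ⟨D, M, hlip, -⟩ := exists_lipschitzWith_fluidDrift_max hnet
  have hmax : ∀ {Z : ℝ → Fin K → ℝ}, net.IsLimitSolution x₀ Z → ∀ s, 0 ≤ s →
      HasDerivWithinAt Z (net.fluidDrift fun k => max (Z s k) 0) (Ici 0) s := fun {Z} hZ s hs => by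
    rw [show (fun k => max (Z s k) 0) = Z s from funext fun k => max_eq_left (hZ.2.1 s hs k)]
    exact hZ.hasDerivWithinAt hs
  have hcont : ∀ {Z : ℝ → Fin K → ℝ}, net.IsLimitSolution x₀ Z → ContinuousOn Z (Icc 0 t) :=
    fun hZ s hs => (hmax hZ s hs.1).continuousWithinAt.mono Icc_subset_Ici_self
  refine ODE_solution_unique (v := fun _ x => net.fluidDrift fun k => max (x k) 0)
    (fun _ => hlip) (hcont hY) (fun s hs => (hmax hY s hs.1).mono (Ici_subset_Ici.2 hs.1))
    (hcont hX) (fun s hs => (hmax hX s hs.1).mono (Ici_subset_Ici.2 hs.1)) ?_ ⟨ht, le_rfl⟩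
  rw [hX.1, hY.1]

/-- First-order expansion of a solution backwards from time `t + h`. -/
lemma exists_abs_increment_sub_le (hnet : net.IsAcyclic) :
    ∃ M c, 0 ≤ M ∧ 0 ≤ c ∧ ∀ (x₀ : Fin K → ℝ) (X : ℝ → Fin K → ℝ), net.IsLimitSolution x₀ X →
      ∀ t h : ℝ, 0 ≤ t → 0 ≤ h → ∀ k, |X (t + h) k - X t k| ≤ M * h ∧
        |X (t + h) k - X t k - h * net.fluidDrift (X (t + h)) k| ≤ c * h ^ 2 := by
  obtain ⟨D, hD, hlip⟩ := exists_abs_fluidDrift_sub_le hnet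
  obtain ⟨M, hM, hbound⟩ := exists_fluidDrift_bound hnet
  refine ⟨M, D * (K * M), hM, by positivity, fun x₀ X hX t h ht hh k => ?_⟩
  have hincr : ∀ s u : ℝ, 0 ≤ s → s ≤ u → ∀ j, |X u j - X s j| ≤ M * (u - s) := by
    intro s u hs hsu j
    have := (convex_Icc s u).norm_image_sub_le_of_norm_hasDerivWithin_le
      (f := fun r => X r j) (f' := fun r => net.fluidDrift (X r) j) (C := M)
      (fun r hr => (hX.2.2 r (hs.trans hr.1) j).mono fun y hy => hs.trans hy.1)
      (fun r hr => hbound _ (hX.2.1 r (hs.trans hr.1)) j) (left_mem_Icc.2 hsu) (right_mem_Icc.2 hsu)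
    rwa [Real.norm_eq_abs, Real.norm_eq_abs, abs_of_nonneg (sub_nonneg.2 hsu)] at this
  refine ⟨by simpa using hincr t (t + h) ht (by linarith) k, ?_⟩
  have hth : t ≤ t + h := by linarith
  have := (convex_Icc t (t + h)).norm_image_sub_le_of_norm_hasDerivWithin_le
    (f := fun r => X r k - r * net.fluidDrift (X (t + h)) k)
    (f' := fun r => net.fluidDrift (X r) k - 1 * net.fluidDrift (X (t + h)) k)
    (C := D * (K * M) * h)
    (fun r hr => ((hX.2.2 r (ht.trans hr.1) k).mono fun y hy => ht.trans hy.1).sub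
      ((hasDerivWithinAt_id r _).mul_const _))
    (fun r hr => ?_) (left_mem_Icc.2 hth) (right_mem_Icc.2 hth)
  · rw [Real.norm_eq_abs, Real.norm_eq_abs, add_sub_cancel_left, abs_of_nonneg hh] at this
    calc _ = |X (t + h) k - (t + h) * net.fluidDrift (X (t + h)) k -
          (X t k - t * net.fluidDrift (X (t + h)) k)| := by congr 1; ring
      _ ≤ _ := this
      _ = _ := by ring
  · rw [one_mul, Real.norm_eq_abs, abs_sub_comm]
    refine (hlip _ _ (hX.2.1 _ (ht.trans hth)) (hX.2.1 r (ht.trans hr.1)) k).trans ?_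
    rw [mul_assoc]
    refine mul_le_mul_of_nonneg_left ?_ hD
    calc ∑ j, |X (t + h) j - X r j| ≤ ∑ _j : Fin K, M * h :=
          Finset.sum_le_sum fun j _ => (hincr r (t + h) (ht.trans hr.1) hr.2 j).trans
            (mul_le_mul_of_nonneg_left (by linarith [hr.1]) hM)
      _ = K * M * h := by simp; ring

end FlowNetwork

/-! ### Uniform bounds for functionals with small drift -/

namespace IsMarkovJump

variable {S : Type*} [MeasurableSpace S] [MeasurableSingletonClass S] [Countable S] [DecidableEq S]
  [TopologicalSpace S] {q : S → S → ℝ} {Ω : Type*} [MeasurableSpace Ω] {P : Measure Ω}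
  [IsProbabilityMeasure P] {N : ℝ≥0 → Ω → S}

/-- If the mean of a bounded function `w` grows over a time `h` by at most the factor `1 + C h` and
the amount `b h + c h ^ 2`, then a maximal inequality holds along the multiples of `h`: the
corrected process `(1 + C h) ^ (m - j) (w + (m - j) (b h + c h ^ 2))` is a supermartingale. -/
lemma mul_measure_exists_grid_le (hN : IsMarkovJump q P N) {w : ℝ≥0 → S → ℝ} {B C b c : ℝ}
    (hw0 : ∀ t n, 0 ≤ w t n) (hwB : ∀ t n, w t n ≤ B) (hC : 0 ≤ C) (hb : 0 ≤ b) (hc : 0 ≤ c)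
    (hstep : ∀ p, IsTransitionFunction q p → ∀ (t h : ℝ≥0) n,
      ∫ i, w (t + h) i ∂(p h n) ≤ (1 + C * h) * w t n + h * b + c * h ^ 2)
    {δ : ℝ} (h : ℝ≥0) (m : ℕ) :
    ENNReal.ofReal δ * P {ω | ∃ j : ℕ, j ≤ m ∧ δ < w (j * h) (N (j * h) ω)} ≤
      ENNReal.ofReal (Real.exp (C * (m * h))) * (∫⁻ ω, ENNReal.ofReal (w 0 (N 0 ω)) ∂P +
        ENNReal.ofReal (m * h * b + c * (m * h) * h)) := by
  obtain ⟨p, hp, hmarkov⟩ := hN.exists_setLIntegral_eq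
  have hmk := hp.isMarkov
  have hh := h.coe_nonneg
  have hCh : 1 ≤ 1 + C * h := le_add_of_nonneg_right (mul_nonneg hC hh)
  set r : ℝ := h * b + c * h ^ 2 with hr
  have hr0 : 0 ≤ r := by positivity
  set v : ℕ → S → ℝ := fun j n => (1 + C * h) ^ (m - j) * (w (j * h) n + (m - j : ℕ) * r) with hv
  have hvw : ∀ (j : ℕ) n, w (j * h) n ≤ v j n := fun j n =>
    (le_add_of_nonneg_right (by positivity)).trans
      (le_mul_of_one_le_left (add_nonneg (hw0 _ _) (by positivity)) (one_le_pow₀ hCh))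
  have hv0 : ∀ j n, 0 ≤ v j n := fun j n => (hw0 _ n).trans (hvw j n)
  have hint : ∀ t n s, Integrable (w t) (p s n) := fun t n s =>
    Integrable.of_bound (measurable_of_countable _).aestronglyMeasurable B
      (Eventually.of_forall fun j => by rw [Real.norm_of_nonneg (hw0 t j)]; exact hwB t j)
  have hvstep : ∀ j < m, ∀ n, ∫⁻ i, ENNReal.ofReal (v (j + 1) i) ∂(p h n) ≤
      ENNReal.ofReal (v j n) := by
    intro j hj n
    have hvint : Integrable (v (j + 1)) (p h n) :=
      ((hint _ n h).add (integrable_const _)).const_mul _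
    rw [← ofReal_integral_eq_lintegral_ofReal hvint (Eventually.of_forall (hv0 (j + 1)))]
    refine ENNReal.ofReal_le_ofReal ?_
    simp only [hv]
    rw [integral_const_mul, integral_add (hint _ n h) (integrable_const _), integral_const,
      probReal_univ, one_smul]
    obtain ⟨d, hd⟩ : ∃ d, m - j = d + 1 := ⟨m - j - 1, by omega⟩
    rw [show m - (j + 1) = d by omega, hd, pow_succ, mul_assoc]
    refine mul_le_mul_of_nonneg_left ?_ (by positivity)
    have h1 := hstep p hp (j * h) h n
    have h2 : 0 ≤ C * h * ((d + 1 : ℕ) * r) := by positivity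
    rw [show ((j + 1 : ℕ) : ℝ≥0) * h = j * h + h by push_cast; ring]
    push_cast at h2 ⊢
    linarith
  have hmeas : ∀ j, Measurable (fun n => ENNReal.ofReal (v j n)) := fun j =>
    measurable_of_countable _
  have hmax := mul_measure_exists_le_le_lintegral (P := P)
    (V := fun j ω => ENNReal.ofReal (v j (N (j * h) ω)))
    (fun j => (hmeas j).comp (hN.measurable _)) (ENNReal.ofReal δ) m (fun j hj => by
      have hE : MeasurableSet[⨆ u ≤ j * h, MeasurableSpace.comap (N u) inferInstance]
          {ω | ∀ i ≤ j, ENNReal.ofReal (v i (N (i * h) ω)) < ENNReal.ofReal δ} := by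
        have : {ω | ∀ i ≤ j, ENNReal.ofReal (v i (N (i * h) ω)) < ENNReal.ofReal δ} =
            ⋂ i ≤ j, N (i * h) ⁻¹' {n | ENNReal.ofReal (v i n) < ENNReal.ofReal δ} := by
          ext; simp
        rw [this]
        refine MeasurableSet.iInter fun i => MeasurableSet.iInter fun hi => ?_
        have hle : (i : ℝ≥0) * h ≤ j * h := by gcongr
        exact le_iSup₂ (f := fun u (_ : u ≤ j * h) =>
          MeasurableSpace.comap (N u) (inferInstance : MeasurableSpace S)) (i * h) hle _
          ⟨_, Set.to_countable _ |>.measurableSet, rfl⟩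
      have := hmarkov (j * h) h _ hE _ (hmeas (j + 1))
      rw [show ((j + 1 : ℕ) : ℝ≥0) * h = j * h + h by push_cast; ring, this]
      exact lintegral_mono fun ω => hvstep j hj _)
  calc _ ≤ ENNReal.ofReal δ *
        P {ω | ∃ j ≤ m, ENNReal.ofReal δ ≤ ENNReal.ofReal (v j (N (j * h) ω))} := by
        refine mul_le_mul_right (measure_mono ?_) _
        rintro ω ⟨j, hj, hlt⟩
        exact ⟨j, hj, ENNReal.ofReal_le_ofReal (hlt.le.trans (hvw _ _))⟩
    _ ≤ _ := hmax
    _ = ENNReal.ofReal ((1 + C * h) ^ m) * (∫⁻ ω, ENNReal.ofReal (w 0 (N 0 ω)) ∂P +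
        ENNReal.ofReal (m * h * b + c * (m * h) * h)) := by
        have hmeas0 : Measurable fun ω => ENNReal.ofReal (w 0 (N 0 ω)) +
            ENNReal.ofReal (m * h * b + c * (m * h) * h) :=
          ((measurable_of_countable fun n => ENNReal.ofReal (w 0 n)).comp
            (hN.measurable 0)).add_const _
        rw [← mul_one (ENNReal.ofReal (m * h * b + _)), ← measure_univ (μ := P),
          ← lintegral_const, ← lintegral_add_right _ measurable_const,
          ← lintegral_const_mul _ hmeas0]
        refine lintegral_congr fun ω => ?_
        rw [← ENNReal.ofReal_add (hw0 _ _) (by positivity), ← ENNReal.ofReal_mul (by positivity)]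
        simp only [hv, hr, Nat.cast_zero, zero_mul, Nat.sub_zero]
        congr 3
        ring
    _ ≤ _ := by
        gcongr
        calc (1 + C * h) ^ m ≤ Real.exp (C * h) ^ m := by
              gcongr
              rw [add_comm]
              exact Real.add_one_le_exp _
          _ = _ := by rw [← Real.exp_nat_mul]; congr 1; ring

/-- The maximal inequality over a time interval, from the one along dyadic grids. -/
lemma mul_measure_exists_le (hN : IsMarkovJump q P N) {w : ℝ≥0 → S → ℝ} {B C b c : ℝ}
    (hw0 : ∀ t n, 0 ≤ w t n) (hwB : ∀ t n, w t n ≤ B) (hC : 0 ≤ C) (hb : 0 ≤ b) (hc : 0 ≤ c)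
    (hstep : ∀ p, IsTransitionFunction q p → ∀ (t h : ℝ≥0) n,
      ∫ i, w (t + h) i ∂(p h n) ≤ (1 + C * h) * w t n + h * b + c * h ^ 2)
    (hright : ∀ ω t, ContinuousWithinAt (fun s => w s (N s ω)) (Ici t) t) (δ : ℝ) (T : ℝ≥0) :
    ENNReal.ofReal δ * P {ω | ∃ t ≤ T, δ < w t (N t ω)} ≤
      ENNReal.ofReal (Real.exp (C * T)) * (∫⁻ ω, ENNReal.ofReal (w 0 (N 0 ω)) ∂P +
        ENNReal.ofReal (T * b)) := by
  set A : ℕ → Set Ω := fun i =>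
    {ω | ∃ j : ℕ, j ≤ 2 ^ i ∧ δ < w (j * (T / 2 ^ i)) (N (j * (T / 2 ^ i)) ω)} with hA
  have hmono : Monotone A := monotone_nat_of_le_succ fun i ω => by
    rintro ⟨j, hj, hlt⟩
    refine ⟨2 * j, by rw [pow_succ]; omega, ?_⟩
    have : ((2 * j : ℕ) : ℝ≥0) * (T / 2 ^ (i + 1)) = j * (T / 2 ^ i) := by
      rw [pow_succ]; push_cast; field_simp
    rwa [this]
  have hh0 : Tendsto (fun i : ℕ => (T : ℝ) / 2 ^ i) atTop (𝓝 0) := by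
    simpa [div_eq_mul_inv] using
      (tendsto_pow_atTop_nhds_zero_of_lt_one (r := (2 : ℝ)⁻¹) (by norm_num) (by norm_num)).const_mul
        (T : ℝ)
  have hsub : {ω | ∃ t ≤ T, δ < w t (N t ω)} ⊆ ⋃ i, A i := by
    rintro ω ⟨t, ht, hlt⟩
    rw [mem_iUnion]
    rcases eq_or_lt_of_le (zero_le (a := T)) with rfl | hT
    · obtain rfl : t = 0 := le_antisymm ht zero_le
      exact ⟨0, 0, by simp, by simpa using hlt⟩
    -- The grid points `⌈t / h⌉ h` decrease to `t` as `h = T / 2 ^ i` tends to zero.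
    have hs : Tendsto (fun i : ℕ => (⌈t / (T / 2 ^ i)⌉₊ : ℝ≥0) * (T / 2 ^ i)) atTop (𝓝[≥] t) := by
      have hpos : ∀ i : ℕ, 0 < T / 2 ^ i := fun i => by positivity
      have hge : ∀ i : ℕ, t ≤ (⌈t / (T / 2 ^ i)⌉₊ : ℝ≥0) * (T / 2 ^ i) := fun i =>
        (div_le_iff₀ (hpos i)).1 (Nat.le_ceil _)
      refine tendsto_nhdsWithin_iff.2 ⟨?_, Eventually.of_forall hge⟩
      have hupper : Tendsto (fun i : ℕ => t + T / 2 ^ i) atTop (𝓝 t) := by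
        rw [← NNReal.tendsto_coe]
        push_cast
        simpa using hh0.const_add (t : ℝ)
      refine tendsto_of_tendsto_of_tendsto_of_le_of_le tendsto_const_nhds hupper hge fun i => ?_
      calc (⌈t / (T / 2 ^ i)⌉₊ : ℝ≥0) * (T / 2 ^ i) ≤ (t / (T / 2 ^ i) + 1) * (T / 2 ^ i) := by
            gcongr
            exact (Nat.ceil_lt_add_one zero_le).le
        _ = t + T / 2 ^ i := by
            rw [add_mul, one_mul, div_mul_cancel₀ _ (hpos i).ne']
    have hev := ((hright ω t).tendsto.comp hs).eventually (lt_mem_nhds hlt)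
    obtain ⟨i, hi⟩ := hev.exists
    refine ⟨i, _, Nat.ceil_le.2 ?_, hi⟩
    rw [div_le_iff₀ (by positivity)]
    push_cast
    rw [mul_div_cancel₀ _ (by positivity)]
    exact ht
  refine (mul_le_mul_right (measure_mono hsub) _).trans ?_
  have hlim := ENNReal.Tendsto.const_mul (a := ENNReal.ofReal δ)
    (tendsto_measure_iUnion_atTop (μ := P) hmono) (Or.inr ENNReal.ofReal_ne_top)
  have hlim' : Tendsto (fun i : ℕ => ENNReal.ofReal (Real.exp (C * T)) *
      (∫⁻ ω, ENNReal.ofReal (w 0 (N 0 ω)) ∂P + ENNReal.ofReal (T * b + c * T * (T / 2 ^ i))))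
      atTop (𝓝 (ENNReal.ofReal (Real.exp (C * T)) * (∫⁻ ω, ENNReal.ofReal (w 0 (N 0 ω)) ∂P +
        ENNReal.ofReal (T * b)))) := by
    refine ENNReal.Tendsto.const_mul (Tendsto.const_add _ ?_) (Or.inr ENNReal.ofReal_ne_top)
    refine ENNReal.tendsto_ofReal ?_
    simpa using (hh0.const_mul (c * T)).const_add (T * b)
  refine le_of_tendsto_of_tendsto' hlim hlim' fun i => ?_
  have := hN.mul_measure_exists_grid_le hw0 hwB hC hb hc hstep (δ := δ) (T / 2 ^ i) (2 ^ i)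
  have e : (2 : ℝ) ^ i * (T / 2 ^ i) = T := by field_simp
  push_cast at this
  rwa [e] at this

end IsMarkovJump

/-! ### A bounded Lyapunov function -/

/-- A bounded smooth substitute for the square, so that initial states and numbers of flows need not
be integrable. -/
noncomputable def boundedSq (z : ℝ) : ℝ := z ^ 2 / (1 + z ^ 2)

/-- The derivative of `boundedSq`. -/
noncomputable def boundedSqDeriv (z : ℝ) : ℝ := 2 * z / (1 + z ^ 2) ^ 2

lemma boundedSq_nonneg (z : ℝ) : 0 ≤ boundedSq z := by unfold boundedSq; positivity

lemma boundedSq_le_one (z : ℝ) : boundedSq z ≤ 1 :=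
  div_le_one_of_le₀ (by linarith) (by positivity)

lemma boundedSq_lt_boundedSq {x y : ℝ} (hx : 0 ≤ x) (hxy : x < |y|) : boundedSq x < boundedSq y := by
  have h : x ^ 2 < y ^ 2 := by rw [← sq_abs y]; exact pow_lt_pow_left₀ hxy hx two_ne_zero
  unfold boundedSq
  rw [div_lt_div_iff₀ (by positivity) (by positivity)]
  linarith

lemma abs_boundedSq_sub_le (x y : ℝ) : |boundedSq y - boundedSq x| ≤ |y - x| := by
  have hx : 0 < 1 + x ^ 2 := by positivity
  have hy : 0 < 1 + y ^ 2 := by positivity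
  have e : boundedSq y - boundedSq x = (y - x) * ((y + x) / ((1 + x ^ 2) * (1 + y ^ 2))) := by
    unfold boundedSq; field_simp; ring
  rw [e, abs_mul]
  refine mul_le_of_le_one_right (abs_nonneg _) ?_
  rw [abs_div, abs_of_pos (mul_pos hx hy), div_le_one (mul_pos hx hy), abs_le]
  constructor <;> nlinarith [sq_nonneg (x + 1), sq_nonneg (y + 1), sq_nonneg (x - 1),
    sq_nonneg (y - 1), mul_nonneg (sq_nonneg x) (sq_nonneg y)]

lemma boundedSq_le_abs (z : ℝ) : boundedSq z ≤ |z| := by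
  have := (le_abs_self _).trans (abs_boundedSq_sub_le 0 z)
  simpa [boundedSq] using this

lemma abs_boundedSq_taylor_le (x y : ℝ) :
    |boundedSq y - boundedSq x - boundedSqDeriv x * (y - x)| ≤ 2 * (y - x) ^ 2 := by
  have hx : 0 < 1 + x ^ 2 := by positivity
  have hy : 0 < 1 + y ^ 2 := by positivity
  have e : boundedSq y - boundedSq x - boundedSqDeriv x * (y - x) =
      (1 - x ^ 2 - 2 * x * y) / ((1 + x ^ 2) ^ 2 * (1 + y ^ 2)) * (y - x) ^ 2 := by
    unfold boundedSq boundedSqDeriv; field_simp; ring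
  rw [e, abs_mul, abs_of_nonneg (sq_nonneg (y - x))]
  refine mul_le_mul_of_nonneg_right ?_ (sq_nonneg _)
  rw [abs_div, abs_of_pos (a := _ * _) (by positivity), div_le_iff₀ (by positivity)]
  have h1 : |1 - x ^ 2 - 2 * x * y| ≤ 2 * ((1 + x ^ 2) * (1 + y ^ 2)) := by
    rw [abs_le]
    constructor <;> nlinarith [sq_nonneg (x + y), sq_nonneg (x - y), sq_nonneg x, sq_nonneg y,
      mul_nonneg (sq_nonneg x) (sq_nonneg y)]
  have h2 : (1 + x ^ 2) * (1 + y ^ 2) ≤ (1 + x ^ 2) ^ 2 * (1 + y ^ 2) := by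
    refine mul_le_mul_of_nonneg_right ?_ hy.le
    nlinarith [sq_nonneg x]
  linarith

lemma abs_boundedSqDeriv_le_one (z : ℝ) : |boundedSqDeriv z| ≤ 1 := by
  unfold boundedSqDeriv
  rw [abs_div, abs_of_nonneg (a := _ ^ 2) (by positivity), div_le_one (by positivity), abs_le]
  constructor <;> nlinarith [sq_nonneg (z + 1), sq_nonneg (z - 1), sq_nonneg z, sq_nonneg (z ^ 2)]

lemma boundedSqDeriv_sq_le (z : ℝ) : boundedSqDeriv z ^ 2 ≤ 4 * boundedSq z := by
  have hz : 1 ≤ 1 + z ^ 2 := by linarith [sq_nonneg z]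
  have e : boundedSqDeriv z ^ 2 = 4 * z ^ 2 / (1 + z ^ 2) ^ 4 := by
    unfold boundedSqDeriv; rw [div_pow]; ring
  rw [e, boundedSq, mul_div_assoc]
  gcongr
  exact le_self_pow₀ hz (by norm_num)

lemma min_one_abs_sq_le (z : ℝ) : min 1 |z| ^ 2 ≤ 2 * boundedSq z := by
  have hz : 0 < 1 + z ^ 2 := by positivity
  rw [boundedSq, mul_div_assoc', le_div_iff₀ hz]
  have hm0 : 0 ≤ min 1 |z| := le_min zero_le_one (abs_nonneg _)
  have h1 : min 1 |z| ^ 2 ≤ 1 := pow_le_one₀ hm0 (min_le_left _ _)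
  have h2 : min 1 |z| ^ 2 ≤ z ^ 2 := by
    rw [← sq_abs z]; exact pow_le_pow_left₀ hm0 (min_le_right _ _) 2
  nlinarith [sq_nonneg z]

lemma abs_boundedSqDeriv_mul_min_le (y z : ℝ) :
    |boundedSqDeriv y| * min 1 |z| ≤ 2 * boundedSq y + boundedSq z := by
  have h1 := boundedSqDeriv_sq_le y
  have h2 := min_one_abs_sq_le z
  rw [← sq_abs] at h1
  nlinarith [sq_nonneg (|boundedSqDeriv y| - min 1 |z|)]

namespace FlowNetwork

variable {L K : ℕ} {net : FlowNetwork L K}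

/-- The drift is bounded and Lipschitz, so that its variation is bounded by truncated distances. -/
lemma exists_abs_fluidDrift_sub_le_min (hnet : net.IsAcyclic) :
    ∃ D, 0 ≤ D ∧ ∀ x y : Fin K → ℝ, (∀ k, 0 ≤ x k) → (∀ k, 0 ≤ y k) → ∀ k,
      |net.fluidDrift x k - net.fluidDrift y k| ≤ D * ∑ j, min 1 |x j - y j| := by
  obtain ⟨D, hD, hlip⟩ := exists_abs_fluidDrift_sub_le hnet
  obtain ⟨M, hM, hbound⟩ := exists_fluidDrift_bound hnet
  have hmin : ∀ z : ℝ, 0 ≤ min 1 |z| := fun z => le_min zero_le_one (abs_nonneg _)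
  refine ⟨D + 2 * M, by positivity, fun x y hx hy k => ?_⟩
  have hsum : 0 ≤ ∑ j, min 1 |x j - y j| := Finset.sum_nonneg fun _ _ => hmin _
  rw [add_mul]
  by_cases h : ∀ j, |x j - y j| ≤ 1
  · refine (hlip x y hx hy k).trans (le_add_of_le_of_nonneg (le_of_eq ?_) (by positivity))
    congr 1
    exact Finset.sum_congr rfl fun j _ => (min_eq_right (h j)).symm
  · push Not at h
    obtain ⟨j, hj⟩ := h
    have h1 : 1 ≤ ∑ j, min 1 |x j - y j| := (min_eq_left hj.le).symm.le.trans
      (Finset.single_le_sum (f := fun j => min 1 |x j - y j|) (fun _ _ => hmin _)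
        (Finset.mem_univ j))
    have h2 : |net.fluidDrift x k - net.fluidDrift y k| ≤ 2 * M :=
      (abs_sub _ _).trans (by linarith [hbound x hx k, hbound y hy k])
    refine le_add_of_nonneg_of_le (by positivity) (h2.trans ?_)
    exact le_mul_of_one_le_right (by positivity) h1

/-- The contribution of the drift to the growth of the Lyapunov function. -/
lemma exists_sum_boundedSqDeriv_mul_le (hnet : net.IsAcyclic) :
    ∃ C, 0 ≤ C ∧ ∀ x y : Fin K → ℝ, (∀ k, 0 ≤ x k) → (∀ k, 0 ≤ y k) →
      ∑ k, boundedSqDeriv (x k - y k) * (net.fluidDrift x k - net.fluidDrift y k) ≤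
        C * ∑ k, boundedSq (x k - y k) := by
  obtain ⟨D, hD, hlip⟩ := exists_abs_fluidDrift_sub_le_min hnet
  refine ⟨D * (3 * K), by positivity, fun x y hx hy => ?_⟩
  calc _ ≤ ∑ k, D * ∑ j, (2 * boundedSq (x k - y k) + boundedSq (x j - y j)) := by
        refine Finset.sum_le_sum fun k _ => (le_abs_self _).trans ?_
        rw [abs_mul]
        calc _ ≤ |boundedSqDeriv (x k - y k)| * (D * ∑ j, min 1 |x j - y j|) :=
              mul_le_mul_of_nonneg_left (hlip x y hx hy k) (abs_nonneg _)
          _ = D * ∑ j, |boundedSqDeriv (x k - y k)| * min 1 |x j - y j| := by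
              rw [Finset.mul_sum, Finset.mul_sum, Finset.mul_sum]
              exact Finset.sum_congr rfl fun j _ => by ring
          _ ≤ _ := mul_le_mul_of_nonneg_left
              (Finset.sum_le_sum fun j _ => abs_boundedSqDeriv_mul_min_le _ _) hD
    _ = _ := by
        rw [← Finset.mul_sum]
        simp only [Finset.sum_add_distrib, Finset.sum_const, Finset.card_univ, Fintype.card_fin,
          nsmul_eq_mul, ← Finset.mul_sum]
        ring

/-- A bounded smooth measure of the distance between the rescaled numbers of flows `n` and the state
`x` of the fluid limit: a sum over coordinates, so that a jump affects one term only. -/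
noncomputable def lyapunov (net : FlowNetwork L K) (β : ℕ) (x : Fin K → ℝ) (n : Fin K → ℕ) : ℝ :=
  ∑ k, boundedSq (net.rescale β n k - x k)

lemma rescale_nonneg (β : ℕ) (n : Fin K → ℕ) (k : Fin K) : 0 ≤ net.rescale β n k :=
  mul_nonneg (by positivity) (mul_nonneg (net.accessRate_pos k).le (Nat.cast_nonneg _))

lemma lyapunov_nonneg (β : ℕ) (x : Fin K → ℝ) (n : Fin K → ℕ) : 0 ≤ net.lyapunov β x n :=
  Finset.sum_nonneg fun _ _ => boundedSq_nonneg _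

lemma lyapunov_le (β : ℕ) (x : Fin K → ℝ) (n : Fin K → ℕ) : net.lyapunov β x n ≤ K := by
  refine (Finset.sum_le_sum fun k _ => boundedSq_le_one _).trans ?_
  simp

lemma lyapunov_sub_of_eq_off {β : ℕ} {x : Fin K → ℝ} {n m : Fin K → ℕ} {k : Fin K}
    (h : ∀ j, j ≠ k → m j = n j) : net.lyapunov β x m - net.lyapunov β x n =
      boundedSq (net.rescale β m k - x k) - boundedSq (net.rescale β n k - x k) := by
  rw [lyapunov, lyapunov, ← Finset.sum_sub_distrib]
  refine Finset.sum_eq_single k (fun j _ hj => ?_) (fun hk => absurd (Finset.mem_univ k) hk)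
  simp [rescale, h j hj]

/-- The generator of the rescaled process applied to the Lyapunov function: jumps of size `a / β`
at rates of order `β` give the drift, up to a second-order term of order `1 / β`. -/
lemma sum_rate_mul_lyapunov_sub_le (hnet : net.IsAcyclic) {β : ℕ} (hβ : 0 < β) (x : Fin K → ℝ)
    (n : Fin K → ℕ) :
    ∑ k, ((net.scale β hβ).arrivalRate k *
          (net.lyapunov β x (n + Pi.single k 1) - net.lyapunov β x n) +
        (net.scale β hβ).serviceRate k * (net.scale β hβ).allocation n k *
          (net.lyapunov β x (n - Pi.single k 1) - net.lyapunov β x n)) ≤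
      ∑ k, boundedSqDeriv (net.rescale β n k - x k) * net.fluidDrift (net.rescale β n) k +
      (∑ k, 2 * net.accessRate k ^ 2 *
        (net.arrivalRate k + net.serviceRate k * ∑ l, net.capacity l)) / β := by
  have hβ' : (0 : ℝ) < β := Nat.cast_pos.2 hβ
  rw [Finset.sum_div, ← Finset.sum_add_distrib]
  refine Finset.sum_le_sum fun k _ => ?_
  set z := net.rescale β n k - x k with hz
  set d := net.accessRate k / β with hd
  set ψ := net.throughput (net.rescale β n) k with hψ
  have hψ0 : 0 ≤ ψ := throughput_nonneg hnet (rescale_nonneg β n) k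
  have hψC : ψ ≤ ∑ l, net.capacity l := throughput_le_sum_capacity hnet (rescale_nonneg β n) k
  have hup : net.lyapunov β x (n + Pi.single k 1) - net.lyapunov β x n ≤
      boundedSqDeriv z * d + 2 * d ^ 2 := by
    rw [lyapunov_sub_of_eq_off (k := k) fun j hj => by simp [hj]]
    have e : net.rescale β (n + Pi.single k 1) k - x k = z + d := by
      simp only [hz, hd, rescale, Pi.add_apply, Pi.single_eq_same]
      push_cast
      field_simp
      ring
    have := (abs_le.1 (abs_boundedSq_taylor_le z (z + d))).2
    rw [add_sub_cancel_left] at this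
    rw [e]
    linarith
  have hdown : ψ * (net.lyapunov β x (n - Pi.single k 1) - net.lyapunov β x n) ≤
      ψ * (-(boundedSqDeriv z * d) + 2 * d ^ 2) := by
    by_cases hn : n k = 0
    · have h0 : ψ = 0 := by
        rw [hψ, ← allocation_scale hβ]
        exact allocation_eq_zero (hnet.scale hβ) hn
      simp [h0]
    refine mul_le_mul_of_nonneg_left ?_ hψ0
    rw [lyapunov_sub_of_eq_off (k := k) fun j hj => by simp [hj]]
    have e : net.rescale β (n - Pi.single k 1) k - x k = z - d := by
      simp only [hz, hd, rescale, Pi.sub_apply, Pi.single_eq_same]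
      rw [Nat.cast_sub (Nat.one_le_iff_ne_zero.2 hn)]
      push_cast
      field_simp
      ring
    have := (abs_le.1 (abs_boundedSq_taylor_le z (z - d))).2
    rw [show z - d - z = -d by ring] at this
    rw [e]
    linarith
  have h1 := mul_le_mul_of_nonneg_left hup (mul_nonneg (net.arrivalRate_nonneg k) hβ'.le)
  have h2 := mul_le_mul_of_nonneg_left hdown (mul_nonneg hβ'.le (net.serviceRate_pos k).le)
  have h3 : 2 * net.accessRate k ^ 2 * (net.arrivalRate k + net.serviceRate k * ψ) / β ≤
      2 * net.accessRate k ^ 2 *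
        (net.arrivalRate k + net.serviceRate k * ∑ l, net.capacity l) / β := by
    have := (net.serviceRate_pos k).le
    gcongr
  rw [allocation_scale hβ]
  change net.arrivalRate k * β * _ + β * net.serviceRate k * ψ * _ ≤ _
  refine le_trans ?_ (add_le_add le_rfl h3)
  calc _ ≤ net.arrivalRate k * β * (boundedSqDeriv z * d + 2 * d ^ 2) +
        β * net.serviceRate k * (ψ * (-(boundedSqDeriv z * d) + 2 * d ^ 2)) := by
        rw [mul_assoc (β * net.serviceRate k)]
        exact add_le_add h1 h2
    _ = _ := by
        rw [fluidDrift, ← hψ, hd]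
        field_simp
        ring

/-- The growth of the Lyapunov function along the fluid limit over a time `h`. The constants `C` and
`b` do not depend on the scaling parameter. -/
lemma exists_integral_lyapunov_le (hnet : net.IsAcyclic) {x₀ : Fin K → ℝ} {X : ℝ → Fin K → ℝ}
    (hX : net.IsLimitSolution x₀ X) :
    ∃ C b, 0 ≤ C ∧ 0 ≤ b ∧ ∀ (β : ℕ) (hβ : 0 < β), ∃ c, 0 ≤ c ∧
      ∀ p, IsTransitionFunction (net.scale β hβ).generator p → ∀ (t h : ℝ≥0) n,
        ∫ m, net.lyapunov β (X ↑(t + h)) m ∂(p h n) ≤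
          (1 + C * h) * net.lyapunov β (X t) n + h * (b / β) + c * h ^ 2 := by
  obtain ⟨C, hC, hdrift⟩ := exists_sum_boundedSqDeriv_mul_le hnet
  obtain ⟨M, c₁, hM, hc₁, hincr⟩ := exists_abs_increment_sub_le hnet
  set b := ∑ k, 2 * net.accessRate k ^ 2 *
    (net.arrivalRate k + net.serviceRate k * ∑ l, net.capacity l) with hb
  refine ⟨C, b, hC, Finset.sum_nonneg fun k _ => ?_, fun β hβ => ?_⟩
  · exact mul_nonneg (by positivity) (add_nonneg (net.arrivalRate_nonneg k)
      (mul_nonneg (net.serviceRate_pos k).le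
        (Finset.sum_nonneg fun l _ => (net.capacity_pos l).le)))
  set Q := ∑ k, ((net.scale β hβ).arrivalRate k +
    (net.scale β hβ).serviceRate k * ∑ l, (net.scale β hβ).capacity l) with hQ
  refine ⟨K * (c₁ + 2 * M ^ 2) + C * (K * M) + K * Q ^ 2, by positivity, fun p hp t h n => ?_⟩
  have hh := h.coe_nonneg
  have hstep := integral_transition_le (hnet.scale hβ) hp
    (f := net.lyapunov β (X ↑(t + h))) (lyapunov_nonneg β _) (lyapunov_le β _) n h
  have hgen := mul_le_mul_of_nonneg_left
    (sum_rate_mul_lyapunov_sub_le hnet hβ (X ↑(t + h)) n) hh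
  rw [← hb] at hgen
  rw [← hQ] at hstep
  rw [NNReal.coe_add] at hstep hgen ⊢
  have hcur : net.lyapunov β (X (t + h)) n ≤ net.lyapunov β (X t) n -
      h * ∑ k, boundedSqDeriv (net.rescale β n k - X (t + h) k) * net.fluidDrift (X (t + h)) k +
      K * (c₁ + 2 * M ^ 2) * h ^ 2 := by
    have : ∀ k, boundedSq (net.rescale β n k - X (t + h) k) ≤ boundedSq (net.rescale β n k - X t k) -
        h * (boundedSqDeriv (net.rescale β n k - X (t + h) k) * net.fluidDrift (X (t + h)) k) +
        (c₁ + 2 * M ^ 2) * h ^ 2 := fun k => by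
      obtain ⟨h1, h2⟩ := hincr x₀ X hX t h t.coe_nonneg hh k
      set z := net.rescale β n k - X (t + h) k with hz
      have e : net.rescale β n k - X t k - z = X (t + h) k - X t k := by rw [hz]; ring
      have h3 := (abs_le.1 (abs_boundedSq_taylor_le z (net.rescale β n k - X t k))).1
      rw [e] at h3
      have h4 : (X (t + h) k - X t k) ^ 2 ≤ M ^ 2 * h ^ 2 := by
        rw [← mul_pow, ← sq_abs]
        exact pow_le_pow_left₀ (abs_nonneg _) h1 2
      have h5 : |boundedSqDeriv z *
          (X (t + h) k - X t k - h * net.fluidDrift (X (t + h)) k)| ≤ c₁ * h ^ 2 := by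
        rw [abs_mul]
        exact (mul_le_of_le_one_left (abs_nonneg _) (abs_boundedSqDeriv_le_one z)).trans h2
      have h6 := (abs_le.1 h5).1
      linarith
    have hs := Finset.sum_le_sum fun k (_ : k ∈ Finset.univ) => this k
    rw [Finset.sum_add_distrib, Finset.sum_sub_distrib, ← Finset.mul_sum] at hs
    simpa [lyapunov, mul_assoc] using hs
  have hlip : net.lyapunov β (X (t + h)) n ≤ net.lyapunov β (X t) n + K * M * h := by
    have : ∀ k, boundedSq (net.rescale β n k - X (t + h) k) ≤
        boundedSq (net.rescale β n k - X t k) + M * h := fun k => by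
      have h1 := (hincr x₀ X hX t h t.coe_nonneg hh k).1
      have h2 := (le_abs_self _).trans (abs_boundedSq_sub_le (net.rescale β n k - X t k)
        (net.rescale β n k - X (t + h) k))
      rw [sub_sub_sub_cancel_left, abs_sub_comm] at h2
      linarith
    have hs := Finset.sum_le_sum fun k (_ : k ∈ Finset.univ) => this k
    rw [Finset.sum_add_distrib] at hs
    simpa [lyapunov, mul_assoc] using hs
  have hd := hdrift (net.rescale β n) (X (t + h)) (rescale_nonneg β n)
    (hX.2.1 _ (add_nonneg t.coe_nonneg hh))
  simp only [mul_sub, Finset.sum_sub_distrib] at hd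
  have hd' := mul_le_mul_of_nonneg_left
    (hd.trans (mul_le_mul_of_nonneg_left hlip hC)) hh
  linarith

end FlowNetwork

/-! ### Convergence to the fluid limit -/

namespace FlowNetwork

variable {L K : ℕ} {net : FlowNetwork L K}

lemma continuousWithinAt_lyapunov {Ω : Type*} [MeasurableSpace Ω] {P : Measure Ω} {β β' : ℕ}
    {hβ : 0 < β'} {N : ℝ≥0 → Ω → Fin K → ℕ} (hN : (net.scale β' hβ).HasFlowDynamics P N)
    {x₀ : Fin K → ℝ} {X : ℝ → Fin K → ℝ} (hX : net.IsLimitSolution x₀ X) (ω : Ω) (t : ℝ≥0) :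
    ContinuousWithinAt (fun s : ℝ≥0 => net.lyapunov β (X s) (N s ω)) (Ici t) t := by
  have hsq : Continuous boundedSq := by
    unfold boundedSq
    exact Continuous.div (by fun_prop) (by fun_prop) fun z => by positivity
  refine tendsto_finsetSum _ fun k _ => ?_
  change ContinuousWithinAt (fun s : ℝ≥0 => boundedSq (net.rescale β (N s ω) k - X s k)) (Ici t) t
  refine hsq.continuousAt.comp_continuousWithinAt (ContinuousWithinAt.sub ?_ ?_)
  · have h1 : Continuous fun n : Fin K → ℕ => net.rescale β n k :=
      (continuous_of_discreteTopology (f := fun i : ℕ =>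
        (β : ℝ)⁻¹ * (net.accessRate k * (i : ℝ)))).comp (continuous_apply k)
    exact h1.continuousAt.comp_continuousWithinAt (hN.right_continuous ω t)
  · exact (hX.2.2 t t.coe_nonneg k).continuousWithinAt.comp
      NNReal.continuous_coe.continuousWithinAt fun s _ => s.coe_nonneg

/-- The initial values `x₀` are nonnegative, since they are limits of nonnegative vectors. -/
lemma nonneg_of_tendsto_initial {Ω : ℕ → Type*} [∀ β, MeasurableSpace (Ω β)]
    {P : (β : ℕ) → Measure (Ω β)} [∀ β, IsProbabilityMeasure (P β)]
    {n : (β : ℕ) → Ω β → Fin K → ℕ} {x₀ : Fin K → ℝ}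
    (h : ∀ ε : ℝ, 0 < ε →
      Tendsto (fun β => P β {ω | ε ≤ ‖net.rescale β (n β ω) - x₀‖}) atTop (𝓝 0)) (k : Fin K) :
    0 ≤ x₀ k := by
  by_contra! hneg
  have huniv : ∀ β, P β {ω | -x₀ k ≤ ‖net.rescale β (n β ω) - x₀‖} = 1 := fun β => by
    rw [← measure_univ (μ := P β)]
    congr 1
    refine eq_univ_of_forall fun ω => ?_
    have h1 := norm_le_pi_norm (net.rescale β (n β ω) - x₀) k
    rw [Pi.sub_apply, Real.norm_eq_abs] at h1
    have h2 := le_abs_self (net.rescale β (n β ω) k - x₀ k)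
    have h3 := net.rescale_nonneg β (n β ω) k
    rw [mem_ofPred_eq]
    linarith
  have := h (-x₀ k) (by linarith)
  simp only [huniv] at this
  exact one_ne_zero (tendsto_nhds_unique tendsto_const_nhds this)

/-- Convergence in probability of the initial states implies that of the means of the bounded
Lyapunov function. -/
lemma tendsto_lintegral_lyapunov {Ω : ℕ → Type*} [∀ β, MeasurableSpace (Ω β)]
    {P : (β : ℕ) → Measure (Ω β)} [∀ β, IsProbabilityMeasure (P β)]
    {n : (β : ℕ) → Ω β → Fin K → ℕ} {x₀ : Fin K → ℝ}
    (h : ∀ ε : ℝ, 0 < ε →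
      Tendsto (fun β => P β {ω | ε ≤ ‖net.rescale β (n β ω) - x₀‖}) atTop (𝓝 0)) :
    Tendsto (fun β => ∫⁻ ω, ENNReal.ofReal (net.lyapunov β x₀ (n β ω)) ∂(P β)) atTop (𝓝 0) := by
  have hbound : ∀ η : ℝ, 0 < η → ∀ β, ∫⁻ ω, ENNReal.ofReal (net.lyapunov β x₀ (n β ω)) ∂(P β) ≤
      ENNReal.ofReal (K * η) + K * P β {ω | η ≤ ‖net.rescale β (n β ω) - x₀‖} := by
    intro η hη β
    set A : Set (Ω β) := {ω | η ≤ ‖net.rescale β (n β ω) - x₀‖} with hA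
    calc _ ≤ ∫⁻ ω, (ENNReal.ofReal (K * η) + A.indicator (fun _ => (K : ℝ≥0∞)) ω) ∂(P β) := by
          refine lintegral_mono fun ω => ?_
          by_cases hω : ω ∈ A
          · rw [indicator_of_mem hω]
            refine le_add_left ((ENNReal.ofReal_le_ofReal (lyapunov_le β _ _)).trans ?_)
            rw [ENNReal.ofReal_natCast]
          · refine le_add_right (ENNReal.ofReal_le_ofReal ?_)
            have hlt : ‖net.rescale β (n β ω) - x₀‖ < η := not_le.1 hω
            calc net.lyapunov β x₀ (n β ω) ≤ ∑ _k : Fin K, η :=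
                  Finset.sum_le_sum fun k _ => (boundedSq_le_abs _).trans
                    ((norm_le_pi_norm (net.rescale β (n β ω) - x₀) k).trans hlt.le)
              _ = K * η := by simp
      _ = ENNReal.ofReal (K * η) + ∫⁻ ω, A.indicator (fun _ => (K : ℝ≥0∞)) ω ∂(P β) := by
          rw [lintegral_add_left measurable_const, lintegral_const, measure_univ, mul_one]
      _ ≤ _ := by
          gcongr
          exact lintegral_indicator_const_le A _
  refine ENNReal.tendsto_nhds_zero.2 fun e he => ?_
  obtain ⟨η, hη, hηe⟩ : ∃ η : ℝ, 0 < η ∧ ENNReal.ofReal (K * η) ≤ e / 2 := by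
    have hlim : Tendsto (fun η : ℝ => ENNReal.ofReal (K * η)) (𝓝[>] 0) (𝓝 0) := by
      have : Tendsto (fun η : ℝ => ENNReal.ofReal (K * η)) (𝓝 0) (𝓝 (ENNReal.ofReal (K * 0))) :=
        ENNReal.tendsto_ofReal (tendsto_id.const_mul _)
      rw [mul_zero, ENNReal.ofReal_zero] at this
      exact this.mono_left nhdsWithin_le_nhds
    obtain ⟨η, h1, h2⟩ := ((ENNReal.tendsto_nhds_zero.1 hlim (e / 2)
      (ENNReal.half_pos he.ne')).and eventually_mem_nhdsWithin).exists
    exact ⟨η, h2, h1⟩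
  have hlim : Tendsto (fun β => (K : ℝ≥0∞) * P β {ω | η ≤ ‖net.rescale β (n β ω) - x₀‖})
      atTop (𝓝 0) := by
    have := ENNReal.Tendsto.const_mul (h η hη) (Or.inr (ENNReal.natCast_ne_top K))
    rwa [mul_zero] at this
  filter_upwards [ENNReal.tendsto_nhds_zero.1 hlim (e / 2) (ENNReal.half_pos he.ne')] with β hβ
  exact (hbound η hη β).trans ((add_le_add hηe hβ).trans (ENNReal.add_halves e).le)

/-- A uniform distance of at least `ε` is detected by the Lyapunov function at some time. -/
lemma exists_boundedSq_lt_lyapunov {β : ℕ} {N : ℝ≥0 → Fin K → ℕ} {X : ℝ → Fin K → ℝ} {T : ℝ≥0}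
    {ε : ℝ} (hε : 0 < ε)
    (h : ENNReal.ofReal ε ≤ ⨆ t ∈ Set.Icc (0 : ℝ≥0) T, edist (net.rescale β (N t)) (X t)) :
    ∃ t ≤ T, boundedSq (ε / 2) < net.lyapunov β (X t) (N t) := by
  have hlt : ENNReal.ofReal (ε / 2) <
      ⨆ t ∈ Set.Icc (0 : ℝ≥0) T, edist (net.rescale β (N t)) (X t) :=
    ((ENNReal.ofReal_lt_ofReal_iff hε).2 (half_lt_self hε)).trans_le h
  obtain ⟨t, ht⟩ := lt_iSup_iff.1 hlt
  obtain ⟨htT, ht⟩ := lt_iSup_iff.1 ht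
  refine ⟨t, htT.2, ?_⟩
  have hdist : ε / 2 < dist (net.rescale β (N t)) (X t) := by
    rw [edist_dist] at ht
    exact (ENNReal.ofReal_lt_ofReal_iff_of_nonneg (by positivity)).1 ht
  obtain ⟨k, hk⟩ : ∃ k, ε / 2 < |net.rescale β (N t) k - X t k| := by
    by_contra! hall
    exact absurd hdist (not_lt.2 ((dist_pi_le_iff (by positivity)).2 hall))
  exact (boundedSq_lt_boundedSq (by positivity) hk).trans_le
    (Finset.single_le_sum (f := fun k => boundedSq (net.rescale β (N t) k - X t k))
      (fun _ _ => boundedSq_nonneg _) (Finset.mem_univ k))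

end FlowNetwork

theorem mainTheorem6 {L K : ℕ} (net : FlowNetwork L K) (hnet : net.IsAcyclic)
    (Ω : ℕ → Type*) [∀ β, MeasurableSpace (Ω β)]
    (P : (β : ℕ) → Measure (Ω β)) [∀ β, IsProbabilityMeasure (P β)]
    (N : (β : ℕ) → ℝ≥0 → Ω β → Fin K → ℕ)
    (hN : ∀ β (hβ : 0 < β), (net.scale β hβ).HasFlowDynamics (P β) (N β))
    (x₀ : Fin K → ℝ)
    (hx₀ : ∀ ε : ℝ, 0 < ε →
      Tendsto (fun β => P β {ω | ε ≤ ‖net.rescale β (N β 0 ω) - x₀‖}) atTop (𝓝 0)) :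
    ∃ X : ℝ → Fin K → ℝ, net.IsLimitSolution x₀ X ∧
      (∀ Y, net.IsLimitSolution x₀ Y → ∀ t, 0 ≤ t → Y t = X t) ∧
      ∀ T : ℝ≥0, ∀ ε : ℝ, 0 < ε →
        Tendsto (fun β => P β {ω | ENNReal.ofReal ε ≤
          ⨆ t ∈ Set.Icc (0 : ℝ≥0) T, edist (net.rescale β (N β t ω)) (X t)}) atTop (𝓝 0) := by
  obtain ⟨X, hX⟩ := FlowNetwork.exists_isLimitSolution hnet
    (FlowNetwork.nonneg_of_tendsto_initial hx₀)
  refine ⟨X, hX, fun Y hY t ht => hX.eq hnet hY ht, fun T ε hε => ?_⟩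
  obtain ⟨C, b, hC, hb, hgrowth⟩ := FlowNetwork.exists_integral_lyapunov_le hnet hX
  have hδ : 0 < boundedSq (ε / 2) := by
    have := boundedSq_lt_boundedSq le_rfl (abs_pos.2 (half_pos hε).ne')
    simpa [boundedSq] using this
  set δ := boundedSq (ε / 2)
  have hδ0 : ENNReal.ofReal δ ≠ 0 := (ENNReal.ofReal_pos.2 hδ).ne'
  have hbound : ∀ β, 0 < β → P β {ω | ENNReal.ofReal ε ≤
      ⨆ t ∈ Set.Icc (0 : ℝ≥0) T, edist (net.rescale β (N β t ω)) (X t)} ≤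
      (ENNReal.ofReal δ)⁻¹ * (ENNReal.ofReal (Real.exp (C * T)) *
        (∫⁻ ω, ENNReal.ofReal (net.lyapunov β x₀ (N β 0 ω)) ∂(P β) +
          ENNReal.ofReal (T * (b / β)))) := by
    intro β hβ
    obtain ⟨c, hc, hstep⟩ := hgrowth β hβ
    have := IsMarkovJump.mul_measure_exists_le (hN β hβ)
      (w := fun t n => net.lyapunov β (X t) n) (fun t n => FlowNetwork.lyapunov_nonneg β _ n)
      (fun t n => FlowNetwork.lyapunov_le β _ n) hC (by positivity) hc hstep
      (FlowNetwork.continuousWithinAt_lyapunov (hN β hβ) hX) δ T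
    rw [NNReal.coe_zero, hX.1] at this
    rw [mul_comm, ← div_eq_mul_inv, ENNReal.le_div_iff_mul_le (Or.inl hδ0)
      (Or.inl ENNReal.ofReal_ne_top), mul_comm]
    exact (mul_le_mul_right
      (measure_mono fun ω hω => FlowNetwork.exists_boundedSq_lt_lyapunov hε hω) _).trans this
  have hinv : Tendsto (fun β : ℕ => ENNReal.ofReal (T * (b / β))) atTop (𝓝 0) := by
    have := ENNReal.tendsto_ofReal
      ((tendsto_const_div_atTop_nhds_zero_nat b).const_mul (T : ℝ))
    rwa [mul_zero, ENNReal.ofReal_zero] at this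
  have hlim := ENNReal.Tendsto.const_mul (a := (ENNReal.ofReal δ)⁻¹)
    (ENNReal.Tendsto.const_mul (a := ENNReal.ofReal (Real.exp (C * T)))
      ((FlowNetwork.tendsto_lintegral_lyapunov hx₀).add hinv) (Or.inr ENNReal.ofReal_ne_top))
    (Or.inr (ENNReal.inv_ne_top.2 hδ0))
  simp only [add_zero, mul_zero] at hlim
  exact tendsto_of_tendsto_of_tendsto_of_le_of_le' tendsto_const_nhds hlim
    (Eventually.of_forall fun _ => zero_le) ((eventually_gt_atTop 0).mono hbound)
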